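/- **Setting.** Let $\Omega\subset\mathbb R^d$, $d\ge 2$, be a bounded polytopal domain (open, connected, bounded, with $\partial\Omega$ a finite union of polytopes). For a finite set $V\subset\mathbb R^d$ let $\operatorname{conv}(V)$ be the set of convex combinations of the points of $V$ with all weights positive (the open convex hull). A regular simplicial triangulation $\mathcal T$ of $\Omega$ is a finite set of pairwise disjoint open $d$-simplices $T=\operatorname{conv}(\{a_0,\dots,a_d\})$ with $\overline\Omega=\bigcup_{T\in\mathcal T}\overline T$ such that for distinct $T,T'\in\mathcal T$ the set $\overline T\cap\overline{T'}$ is empty or the closure of a $j$-subsimplex of $T$ for some $j\in\{0,\dots,d-1\}$. Faces are the (open) $(d-1)$-subsimplices of the elements. Let $\mathbb P_k$ be the polynomials of total degree at most $k$ in $d$ variables, and $\mathbb{RT}_{k}=(\mathbb P_{k})^d\oplus x\operatorname{span}\{x^\alpha:|\alpha|=k\}$. Functions being identified when they agree a.e. in $\Omega$, put $$S_k(\mathcal T,\Omega)=\{v\in H^1(\Omega): v|_T\in\mathbb P_k\ \forall T\in\mathcal T\},\qquad S^0_k(\mathcal T,\Omega)=\{v\in L^1(\Omega): v|_T\in\mathbb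 P_k\ \forall T\in\mathcal T\},$$ $$RT_{k}(\mathcal T,\Omega)=\{v\in L^1(\Omega)^d: v|_T\in\mathbb{RT}_{k}\ \forall T\in\mathcal T,\ [v\cdot n_f]_f=0\text{ for all faces } f\subset\Omega\},$$ where $[v\cdot n_f]_f(x_0)=\lim_{\epsilon\searrow0}(v(x_0+\epsilon n_f)-v(x_0-\epsilon n_f))\cdot n_f$, $x_0\in f$, with $n_f$ a unit normal to $f$. A neural network with input dimension $N_0=d$ and depth $L\ge1$ is a sequence $\Phi=((A_1,b_1,\varrho_1),\dots,(A_L,b_L,\varrho_L))$ with $A_\ell\in\mathbb R^{N_\ell\times N_{\ell-1}}$, $b_\ell\in\mathbb R^{N_\ell}$, $N_\ell\geq 1$, and lists $\varrho_\ell$ of $N_\ell$ activation functions $\mathbb R\to\mathbb R$, where $\varrho_L$ is the identity. Its realization is $R(\Phi)(x)=x_L$ with $x_0=x$, $x_\ell=\varrho_\ell(A_\ell x_{\ell-1}+b_\ell)$ (componentwise). The depth is $L(\Phi)=L$, the size $M(\Phi)$ is the number of nonzero entries of all $A_\ell,b_\ell$, and the layers $1,\dots,L-1$ are the hidden layers.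 Let $\mathrm{ReLU}(x)=\max\{0,x\}$, $\mathrm{ReLU}^r(x)=\max\{0,x\}^r$, and let $\mathrm{BiSU}(x)$ be $1$ for $x>0$ and $0$ for $x\le0$. **Proposition 7.3.** For every integer $r\ge2$ there is a constant $C>0$, depending only on $r$, such that the following holds for all $d\ge2$, all $k\ge1$, all bounded polytopal domains $\Omega\subset\mathbb R^d$, all regular simplicial triangulations $\mathcal T$ of $\Omega$ and all $\blacklozenge\in\{S_k,RT_{k-1},S^0_k\}$. Let $\mu=1$ if $\blacklozenge\in\{S_k,S^0_k\}$ and $\mu=d$ if $\blacklozenge=RT_{k-1}$. The space $\blacklozenge(\mathcal T,\Omega)$ is finite-dimensional. Let $\{\theta_i\}_{i\in\mathcal I}$, $\mathcal I=\{1,\dots,n\}$, be any basis of it, where $\theta_i$ is supported on $s(i)$ elements of $\mathcal T$, that is, $\theta_i$ vanishes a.e. on all elements outside some set of $s(i)$ elements. 1. There is a network $\Phi$, whose hidden activation functions are all ReLU, $\mathrm{ReLU}^r$ or BiSU, such that $R(\Phi)(x)_i=\theta_i(x)$ for a.e. $x\in\Omega$ and all $i\in\mathcal I$. (The output dimension of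 $\Phi$ is $n\mu$, and $R(\Phi)(x)_i\in\mathbb R^\mu$ denotes the $i$-th block.) 2. $L(\Phi)\le C\,d\log(k+1)$ and $M(\Phi)\le C\mu(k+1)^d\sum_{i\in\mathcal I}s(i)$. 3. For every $v\in\blacklozenge(\mathcal T,\Omega)$ there is a network $\Phi^{v}$, whose hidden activation functions are all ReLU, $\mathrm{ReLU}^r$ or BiSU, with $R(\Phi^{v})(x)=v(x)$ for a.e. $x\in\Omega$, $L(\Phi^{v})\le C\,d\log(k+1)$ and $M(\Phi^{v})\le C\mu(k+1)^d\sum_{i\in\mathcal I}s(i)$. The hidden layers (weights, biases and activation functions) of $\Phi^v$ coincide with those of $\Phi$; in particular they do not depend on $v$. For given $r$, the layer dimensions and the lists of activation functions of $\Phi$ and $\Phi^v$ are determined by $\blacklozenge$, $d$, $k$, $n=\dim\blacklozenge(\mathcal T,\Omega)$ and $\{s(i)\}_{i\in\mathcal I}$ alone. 4. The set $\{\Phi^{v}:v\in\blacklozenge(\mathcal T,\Omega)\}$ with the linear operation $\Phi^{v}\mathbin{\widehat+}\lambda\Phi^{w}:=\Phi^{v+\lambda w}$ ($v,w\in\blacklozenge(\mathcal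 T,\Omega)$, $\lambda\in\mathbb R$) is a vector space, and $R(\cdot)$ is a linear isomorphism from it onto $\blacklozenge(\mathcal T,\Omega)$. -/

import Mathlib

open MeasureTheory Filter Topology
open scoped ContDiff Matrix

noncomputable section

namespace FEMNet

/-! ### Neural networks -/

/-- `Net m n`: feedforward neural networks with input dimension `m` and output dimension `n`.
A network is a finite sequence of hidden layers `(A, b, ϱ)`, each of positive width `p`, where `ϱ i`
is the activation function of the `i`-th neuron, followed by an affine output layer `(A, b)`
(in which the activation is the identity). -/
inductive Net : ℕ → ℕ → Type
  | out {m n : ℕ} (A : Matrix (Fin n) (Fin m) ℝ) (b : Fin n → ℝ) : Net m n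
  | hidden {m p n : ℕ} (hp : 0 < p) (A : Matrix (Fin p) (Fin m) ℝ) (b : Fin p → ℝ)
      (ϱ : Fin p → ℝ → ℝ) (Φ : Net p n) : Net m n

/-- The realization of a network. -/
def Net.realize : {m n : ℕ} → Net m n → (Fin m → ℝ) → (Fin n → ℝ)
  | _, _, .out A b, x => A *ᵥ x + b
  | _, _, .hidden _ A b ϱ Φ, x => Φ.realize (fun i => ϱ i ((A *ᵥ x + b) i))

/-- The depth: the number of layers, the output layer included. -/
def Net.depth : {m n : ℕ} → Net m n → ℕ
  | _, _, .out _ _ => 1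
  | _, _, .hidden _ _ _ _ Φ => Φ.depth + 1

/-- The size of one layer: the number of nonzero entries of the weight matrix and of the bias. -/
def layerSize {m n : ℕ} (A : Matrix (Fin n) (Fin m) ℝ) (b : Fin n → ℝ) : ℕ :=
  {q : Fin n × Fin m | A q.1 q.2 ≠ 0}.ncard + {i : Fin n | b i ≠ 0}.ncard

/-- The size of a network: the total number of nonzero weights and biases. -/
def Net.size : {m n : ℕ} → Net m n → ℕ
  | _, _, .out A b => layerSize A b
  | _, _, .hidden _ A b _ Φ => layerSize A b + Φ.size

/-- The layer dimensions `N₀, N₁, …, N_L` (input and output dimension included). -/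
def Net.layerDims : {m n : ℕ} → Net m n → List ℕ
  | m, n, .out _ _ => [m, n]
  | m, _, .hidden _ _ _ _ Φ => m :: Φ.layerDims

/-- The lists of activation functions of the hidden layers. -/
def Net.activations : {m n : ℕ} → Net m n → List (List (ℝ → ℝ))
  | _, _, .out _ _ => []
  | _, _, .hidden _ _ _ ϱ Φ => List.ofFn ϱ :: Φ.activations

/-- The data of a layer with input dimension `q.1` and output dimension `q.2`:
weights, biases and activation functions. -/
abbrev LayerData : Type :=
  (q : ℕ × ℕ) × (Matrix (Fin q.2) (Fin q.1) ℝ × (Fin q.2 → ℝ) × (Fin q.2 → ℝ → ℝ))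

/-- The list of all hidden layers with their weights, biases and activation functions. -/
def Net.hiddenLayers : {m n : ℕ} → Net m n → List LayerData
  | _, _, .out _ _ => []
  | m, _, .hidden (p := p) _ A b ϱ Φ => ⟨(m, p), A, b, ϱ⟩ :: Φ.hiddenLayers

/-- All activation functions in the hidden layers belong to `S`. -/
def Net.ActivationsIn (S : Set (ℝ → ℝ)) {m n : ℕ} (Φ : Net m n) : Prop :=
  ∀ l ∈ Φ.activations, ∀ ϱ ∈ l, ϱ ∈ S

/-- The rectified linear unit. -/
def relu (x : ℝ) : ℝ := max 0 x

/-- The `r`-th power of the rectified linear unit. -/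
def reluPow (r : ℕ) (x : ℝ) : ℝ := relu x ^ r

/-- The binary step unit. -/
def bisu (x : ℝ) : ℝ := if 0 < x then 1 else 0

/-! ### Polytopal domains and regular simplicial meshes -/

/-- The open convex hull of a finite set of points: all convex combinations in which every weight
is positive. For affinely independent points this is the open simplex with these vertices. -/
def openHull {d : ℕ} (V : Finset (Fin d → ℝ)) : Set (Fin d → ℝ) :=
  {x | ∃ w : (Fin d → ℝ) → ℝ,
    (∀ a ∈ V, 0 < w a) ∧ ∑ a ∈ V, w a = 1 ∧ x = ∑ a ∈ V, w a • a}

/-- Bounded polytopal domains: bounded, open and connected, the boundary being a finite union of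
polytopes. -/
structure IsPolytopalDomain {d : ℕ} (Ω : Set (Fin d → ℝ)) : Prop where
  isOpen : IsOpen Ω
  isConnected : IsConnected Ω
  isBounded : Bornology.IsBounded Ω
  frontier_eq : ∃ P : Finset (Finset (Fin d → ℝ)),
    frontier Ω = ⋃ V ∈ P, convexHull ℝ (V : Set (Fin d → ℝ))

/-- `𝒯` is a regular simplicial mesh on `Ω`. A simplex is represented by its set of vertices: the
elements of the mesh are the open `d`-simplices `openHull V` for `V ∈ 𝒯`. Regularity says that the
closures of two distinct elements intersect in the closure of a proper subsimplex (possibly empty,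
which is the case `U = ∅`). -/
structure IsRegularMesh {d : ℕ} (Ω : Set (Fin d → ℝ)) (𝒯 : Finset (Finset (Fin d → ℝ))) :
    Prop where
  card_eq : ∀ V ∈ 𝒯, V.card = d + 1
  affineIndependent : ∀ V ∈ 𝒯, AffineIndependent ℝ (fun a : V => (a : Fin d → ℝ))
  closure_eq : closure Ω = ⋃ V ∈ 𝒯, closure (openHull V)
  disjoint : ∀ V ∈ 𝒯, ∀ W ∈ 𝒯, V ≠ W → Disjoint (openHull V) (openHull W)
  regular : ∀ V ∈ 𝒯, ∀ W ∈ 𝒯, V ≠ W →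
    ∃ U ⊂ V, closure (openHull V) ∩ closure (openHull W) = closure (openHull U)

/-- `F` is the vertex set of a face, i.e. of a `(d-1)`-subsimplex of an element of the mesh. -/
def IsFace {d : ℕ} (𝒯 : Finset (Finset (Fin d → ℝ))) (F : Finset (Fin d → ℝ)) : Prop :=
  ∃ V ∈ 𝒯, F ⊆ V ∧ F.card = d

/-- `ν` is a unit normal (for the Euclidean inner product) to the face with vertex set `F`. -/
def IsUnitNormal {d : ℕ} (F : Finset (Fin d → ℝ)) (ν : Fin d → ℝ) : Prop :=
  ν ⬝ᵥ ν = 1 ∧ ∀ a ∈ F, ∀ b ∈ F, (a - b) ⬝ᵥ ν = 0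

/-! ### Function spaces

Functions on `Ω` are taken up to equality almost everywhere. -/

/-- Almost-everywhere equivalence classes of measurable functions `Ω → ℝ^μ`. -/
abbrev AEFun {d : ℕ} (Ω : Set (Fin d → ℝ)) (μ : ℕ) : Type :=
  (Fin d → ℝ) →ₘ[(volume : Measure (Fin d → ℝ)).restrict Ω] (Fin μ → ℝ)

/-- `g` is the weak partial derivative `∂ᵢ u` on `Ω`. -/
def IsWeakPartialDeriv {d : ℕ} (Ω : Set (Fin d → ℝ)) (i : Fin d) (u g : (Fin d → ℝ) → ℝ) : Prop :=
  ∀ φ : (Fin d → ℝ) → ℝ, ContDiff ℝ ∞ φ → HasCompactSupport φ → tsupport φ ⊆ Ω →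
    ∫ x in Ω, u x * fderiv ℝ φ x (Pi.single i 1) = - ∫ x in Ω, g x * φ x

/-- The Sobolev space `H¹(Ω)`: `u` and all its weak partial derivatives are in `L²(Ω)`. -/
def MemH1 {d : ℕ} (Ω : Set (Fin d → ℝ)) (u : (Fin d → ℝ) → ℝ) : Prop :=
  MemLp u 2 (volume.restrict Ω) ∧
    ∀ i, ∃ g, MemLp g 2 (volume.restrict Ω) ∧ IsWeakPartialDeriv Ω i u g

/-- On every element of the mesh, `u` agrees a.e. (in `Ω`) with a polynomial of total degree at
most `k`. -/
def IsPiecewisePoly {d : ℕ} (Ω : Set (Fin d → ℝ)) (𝒯 : Finset (Finset (Fin d → ℝ))) (k : ℕ)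
    (u : (Fin d → ℝ) → ℝ) : Prop :=
  ∀ V ∈ 𝒯, ∃ p ∈ MvPolynomial.restrictTotalDegree (Fin d) ℝ k,
    ∀ᵐ x ∂(volume.restrict Ω), x ∈ openHull V → u x = MvPolynomial.eval x p

/-- `(P_k)^d ⊕ x · span {x^α : |α| = k}`. -/
def IsRTPoly {d : ℕ} (k : ℕ) (w : Fin d → MvPolynomial (Fin d) ℝ) : Prop :=
  ∃ q : Fin d → MvPolynomial (Fin d) ℝ, ∃ h ∈ MvPolynomial.homogeneousSubmodule (Fin d) ℝ k,
    (∀ j, q j ∈ MvPolynomial.restrictTotalDegree (Fin d) ℝ k) ∧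
      ∀ j, w j = q j + MvPolynomial.X j * h

/-- `u` is, on every (open) element of the mesh, a Raviart-Thomas polynomial of order `k`, and the
jump of its normal component across every interior face vanishes. -/
def IsRTFun {d : ℕ} (Ω : Set (Fin d → ℝ)) (𝒯 : Finset (Finset (Fin d → ℝ))) (k : ℕ)
    (u : (Fin d → ℝ) → (Fin d → ℝ)) : Prop :=
  (∀ V ∈ 𝒯, ∃ w, IsRTPoly k w ∧ ∀ x ∈ openHull V, ∀ j, u x j = MvPolynomial.eval x (w j)) ∧
  ∀ F, IsFace 𝒯 F → openHull F ⊆ Ω → ∀ ν, IsUnitNormal F ν → ∀ x ∈ openHull F,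
    Tendsto (fun ε : ℝ => (u (x + ε • ν) - u (x - ε • ν)) ⬝ᵥ ν) (𝓝[>] 0) (𝓝 0)

/-! ### Closure of these properties under linear combinations -/

theorem integrable_mul_test {d : ℕ} {Ω : Set (Fin d → ℝ)} {u φ : (Fin d → ℝ) → ℝ}
    (hu : MemLp u 2 (volume.restrict Ω)) (hφ : Continuous φ) (hc : HasCompactSupport φ) :
    IntegrableOn (fun x => u x * φ x) Ω :=
  hu.integrable_mul (q := 2) (hφ.memLp_of_hasCompactSupport hc)

theorem MemH1.congr {d : ℕ} {Ω : Set (Fin d → ℝ)} {u v : (Fin d → ℝ) → ℝ} (hu : MemH1 Ω u)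
    (h : u =ᵐ[volume.restrict Ω] v) : MemH1 Ω v := by
  refine ⟨(memLp_congr_ae h).1 hu.1, fun i => ?_⟩
  obtain ⟨g, hg, hw⟩ := hu.2 i
  refine ⟨g, hg, fun φ h1 h2 h3 => ?_⟩
  rw [← hw φ h1 h2 h3]
  refine integral_congr_ae ?_
  filter_upwards [h] with x hx
  rw [hx]

theorem MemH1.zero {d : ℕ} (Ω : Set (Fin d → ℝ)) : MemH1 Ω (fun _ => 0) :=
  ⟨MemLp.zero', fun _ => ⟨fun _ => 0, MemLp.zero', fun φ _ _ _ => by simp⟩⟩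

theorem MemH1.add {d : ℕ} {Ω : Set (Fin d → ℝ)} {u v : (Fin d → ℝ) → ℝ} (hu : MemH1 Ω u)
    (hv : MemH1 Ω v) : MemH1 Ω (fun x => u x + v x) := by
  refine ⟨hu.1.add hv.1, fun i => ?_⟩
  obtain ⟨g, hg, hw⟩ := hu.2 i
  obtain ⟨g', hg', hw'⟩ := hv.2 i
  refine ⟨fun x => g x + g' x, hg.add hg', fun φ h1 h2 h3 => ?_⟩
  have hD : Continuous (fun x => fderiv ℝ φ x (Pi.single i 1)) :=
    (h1.continuous_fderiv (by simp)).clm_apply continuous_const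
  have hDc : HasCompactSupport (fun x => fderiv ℝ φ x (Pi.single i 1)) :=
    h2.fderiv_apply (𝕜 := ℝ) (Pi.single i 1)
  simp only [add_mul]
  rw [integral_add (integrable_mul_test hu.1 hD hDc) (integrable_mul_test hv.1 hD hDc),
    integral_add (integrable_mul_test hg h1.continuous h2)
      (integrable_mul_test hg' h1.continuous h2), hw φ h1 h2 h3, hw' φ h1 h2 h3]
  ring

theorem MemH1.const_mul {d : ℕ} {Ω : Set (Fin d → ℝ)} {u : (Fin d → ℝ) → ℝ} (hu : MemH1 Ω u)
    (c : ℝ) : MemH1 Ω (fun x => c * u x) := by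
  refine ⟨hu.1.const_mul c, fun i => ?_⟩
  obtain ⟨g, hg, hw⟩ := hu.2 i
  refine ⟨fun x => c * g x, hg.const_mul c, fun φ h1 h2 h3 => ?_⟩
  simp only [mul_assoc]
  rw [integral_const_mul, integral_const_mul, hw φ h1 h2 h3]
  ring

theorem IsPiecewisePoly.congr {d : ℕ} {Ω : Set (Fin d → ℝ)} {𝒯 : Finset (Finset (Fin d → ℝ))}
    {k : ℕ} {u v : (Fin d → ℝ) → ℝ} (hu : IsPiecewisePoly Ω 𝒯 k u)
    (h : u =ᵐ[volume.restrict Ω] v) : IsPiecewisePoly Ω 𝒯 k v := by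
  intro V hV
  obtain ⟨p, hp, hx⟩ := hu V hV
  refine ⟨p, hp, ?_⟩
  filter_upwards [hx, h] with x h1 h2 h3
  rw [← h2, h1 h3]

theorem IsPiecewisePoly.zero {d : ℕ} (Ω : Set (Fin d → ℝ)) (𝒯 : Finset (Finset (Fin d → ℝ)))
    (k : ℕ) : IsPiecewisePoly Ω 𝒯 k (fun _ => 0) :=
  fun _ _ => ⟨0, Submodule.zero_mem _, by simp⟩

theorem IsPiecewisePoly.add {d : ℕ} {Ω : Set (Fin d → ℝ)} {𝒯 : Finset (Finset (Fin d → ℝ))}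
    {k : ℕ} {u v : (Fin d → ℝ) → ℝ} (hu : IsPiecewisePoly Ω 𝒯 k u)
    (hv : IsPiecewisePoly Ω 𝒯 k v) : IsPiecewisePoly Ω 𝒯 k (fun x => u x + v x) := by
  intro V hV
  obtain ⟨p, hp, hx⟩ := hu V hV
  obtain ⟨q, hq, hy⟩ := hv V hV
  refine ⟨p + q, Submodule.add_mem _ hp hq, ?_⟩
  filter_upwards [hx, hy] with x h1 h2 h3
  rw [h1 h3, h2 h3, map_add]

theorem IsPiecewisePoly.const_mul {d : ℕ} {Ω : Set (Fin d → ℝ)}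
    {𝒯 : Finset (Finset (Fin d → ℝ))} {k : ℕ} {u : (Fin d → ℝ) → ℝ}
    (hu : IsPiecewisePoly Ω 𝒯 k u) (c : ℝ) : IsPiecewisePoly Ω 𝒯 k (fun x => c * u x) := by
  intro V hV
  obtain ⟨p, hp, hx⟩ := hu V hV
  refine ⟨c • p, Submodule.smul_mem _ c hp, ?_⟩
  filter_upwards [hx] with x h1 h3
  rw [h1 h3, MvPolynomial.smul_eval]

theorem IsRTPoly.add {d k : ℕ} {w w' : Fin d → MvPolynomial (Fin d) ℝ} (hw : IsRTPoly k w)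
    (hw' : IsRTPoly k w') : IsRTPoly k (w + w') := by
  obtain ⟨q, h, hh, hq, he⟩ := hw
  obtain ⟨q', h', hh', hq', he'⟩ := hw'
  refine ⟨q + q', h + h', Submodule.add_mem _ hh hh',
    fun j => Submodule.add_mem _ (hq j) (hq' j), fun j => ?_⟩
  simp only [Pi.add_apply, he, he']
  ring

theorem IsRTPoly.smul {d k : ℕ} {w : Fin d → MvPolynomial (Fin d) ℝ} (hw : IsRTPoly k w)
    (c : ℝ) : IsRTPoly k (c • w) := by
  obtain ⟨q, h, hh, hq, he⟩ := hw
  refine ⟨c • q, c • h, Submodule.smul_mem _ c hh, fun j => Submodule.smul_mem _ c (hq j),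
    fun j => ?_⟩
  simp only [Pi.smul_apply, he, smul_add, mul_smul_comm]

theorem IsRTFun.zero {d : ℕ} (Ω : Set (Fin d → ℝ)) (𝒯 : Finset (Finset (Fin d → ℝ)))
    (k : ℕ) : IsRTFun Ω 𝒯 k (fun _ => 0) := by
  refine ⟨fun V _ => ⟨0, ⟨0, 0, Submodule.zero_mem _, fun _ => Submodule.zero_mem _, ?_⟩, ?_⟩, ?_⟩
  · simp
  · simp
  · intros
    simp

theorem IsRTFun.add {d : ℕ} {Ω : Set (Fin d → ℝ)} {𝒯 : Finset (Finset (Fin d → ℝ))}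
    {k : ℕ} {u v : (Fin d → ℝ) → (Fin d → ℝ)} (hu : IsRTFun Ω 𝒯 k u) (hv : IsRTFun Ω 𝒯 k v) :
    IsRTFun Ω 𝒯 k (fun x => u x + v x) := by
  refine ⟨fun V hV => ?_, fun F h1 h2 ν h3 x hx => ?_⟩
  · obtain ⟨w, hw, he⟩ := hu.1 V hV
    obtain ⟨w', hw', he'⟩ := hv.1 V hV
    refine ⟨w + w', hw.add hw', fun x hx j => ?_⟩
    simp only [Pi.add_apply, map_add, he x hx j, he' x hx j]
  · have := (hu.2 F h1 h2 ν h3 x hx).add (hv.2 F h1 h2 ν h3 x hx)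
    rw [add_zero] at this
    refine this.congr fun ε => ?_
    rw [← add_dotProduct, add_sub_add_comm]

theorem IsRTFun.smul {d : ℕ} {Ω : Set (Fin d → ℝ)} {𝒯 : Finset (Finset (Fin d → ℝ))}
    {k : ℕ} {u : (Fin d → ℝ) → (Fin d → ℝ)} (hu : IsRTFun Ω 𝒯 k u) (c : ℝ) :
    IsRTFun Ω 𝒯 k (fun x => c • u x) := by
  refine ⟨fun V hV => ?_, fun F h1 h2 ν h3 x hx => ?_⟩
  · obtain ⟨w, hw, he⟩ := hu.1 V hV
    refine ⟨c • w, hw.smul c, fun x hx j => ?_⟩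
    simp only [Pi.smul_apply, smul_eq_mul, MvPolynomial.smul_eval, he x hx j]
  · have := (hu.2 F h1 h2 ν h3 x hx).const_mul c
    rw [mul_zero] at this
    refine this.congr fun ε => ?_
    rw [← smul_sub, smul_dotProduct, smul_eq_mul]

/-! ### Finite element spaces

Scalar functions are regarded as functions with values in `ℝ^1`. -/

/-- The space `S_k(𝒯, Ω)` of Lagrange finite elements:
`{v ∈ H¹(Ω) : v|_T ∈ P_k for all T ∈ 𝒯}`. -/
def lagrangeSpace {d : ℕ} (k : ℕ) (Ω : Set (Fin d → ℝ)) (𝒯 : Finset (Finset (Fin d → ℝ))) :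
    Submodule ℝ (AEFun Ω 1) where
  carrier := {v | MemH1 Ω (fun x => v x 0) ∧ IsPiecewisePoly Ω 𝒯 k (fun x => v x 0)}
  zero_mem' := by
    have h : (fun _ : Fin d → ℝ => (0 : ℝ)) =ᵐ[volume.restrict Ω]
        fun x => (0 : AEFun Ω 1) x 0 := by
      filter_upwards [AEEqFun.coeFn_zero (μ := volume.restrict Ω) (α := Fin d → ℝ)
        (β := Fin 1 → ℝ)] with x hx
      simp [hx]
    exact ⟨(MemH1.zero Ω).congr h, (IsPiecewisePoly.zero Ω 𝒯 k).congr h⟩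
  add_mem' := by
    intro u v hu hv
    have h : (fun x => u x 0 + v x 0) =ᵐ[volume.restrict Ω] fun x => (u + v) x 0 := by
      filter_upwards [AEEqFun.coeFn_add u v] with x hx
      simp [hx]
    exact ⟨(hu.1.add hv.1).congr h, (hu.2.add hv.2).congr h⟩
  smul_mem' := by
    intro c u hu
    have h : (fun x => c * u x 0) =ᵐ[volume.restrict Ω] fun x => (c • u) x 0 := by
      filter_upwards [AEEqFun.coeFn_smul c u] with x hx
      simp [hx]
    exact ⟨(hu.1.const_mul c).congr h, (hu.2.const_mul c).congr h⟩

/-- The space `S⁰_k(𝒯, Ω)` of discontinuous piecewise polynomials: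
`{v ∈ L¹(Ω) : v|_T ∈ P_k for all T ∈ 𝒯}`. -/
def discontinuousSpace {d : ℕ} (k : ℕ) (Ω : Set (Fin d → ℝ))
    (𝒯 : Finset (Finset (Fin d → ℝ))) : Submodule ℝ (AEFun Ω 1) where
  carrier := {v | AEEqFun.Integrable v ∧ IsPiecewisePoly Ω 𝒯 k (fun x => v x 0)}
  zero_mem' := by
    have h : (fun _ : Fin d → ℝ => (0 : ℝ)) =ᵐ[volume.restrict Ω]
        fun x => (0 : AEFun Ω 1) x 0 := by
      filter_upwards [AEEqFun.coeFn_zero (μ := volume.restrict Ω) (α := Fin d → ℝ)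
        (β := Fin 1 → ℝ)] with x hx
      simp [hx]
    exact ⟨AEEqFun.integrable_zero, (IsPiecewisePoly.zero Ω 𝒯 k).congr h⟩
  add_mem' := by
    intro u v hu hv
    have h : (fun x => u x 0 + v x 0) =ᵐ[volume.restrict Ω] fun x => (u + v) x 0 := by
      filter_upwards [AEEqFun.coeFn_add u v] with x hx
      simp [hx]
    exact ⟨hu.1.add hv.1, (hu.2.add hv.2).congr h⟩
  smul_mem' := by
    intro c u hu
    have h : (fun x => c * u x 0) =ᵐ[volume.restrict Ω] fun x => (c • u) x 0 := by
      filter_upwards [AEEqFun.coeFn_smul c u] with x hx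
      simp [hx]
    exact ⟨AEEqFun.Integrable.smul hu.1, (hu.2.const_mul c).congr h⟩

/-- The Raviart-Thomas space `RT_k(𝒯, Ω)` of order `k`: the vector fields `v ∈ L¹(Ω)^d` with
`v|_T ∈ (P_k)^d ⊕ x · span {x^α : |α| = k}` for all `T ∈ 𝒯` and without jump of the normal component
across interior faces. Membership is tested on a representative which is polynomial on every open
element, so that the one-sided limits in the jump make sense pointwise. -/
def raviartThomasSpace {d : ℕ} (k : ℕ) (Ω : Set (Fin d → ℝ))
    (𝒯 : Finset (Finset (Fin d → ℝ))) : Submodule ℝ (AEFun Ω d) where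
  carrier := {v | AEEqFun.Integrable v ∧
    ∃ u : (Fin d → ℝ) → (Fin d → ℝ), v =ᵐ[volume.restrict Ω] u ∧ IsRTFun Ω 𝒯 k u}
  zero_mem' := ⟨AEEqFun.integrable_zero, fun _ => 0, AEEqFun.coeFn_zero, IsRTFun.zero Ω 𝒯 k⟩
  add_mem' := by
    rintro u v ⟨hu, u', h1, h2⟩ ⟨hv, v', h3, h4⟩
    refine ⟨hu.add hv, _, ?_, h2.add h4⟩
    filter_upwards [AEEqFun.coeFn_add u v, h1, h3] with x hx hx1 hx3
    rw [hx, Pi.add_apply, hx1, hx3]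
  smul_mem' := by
    rintro c u ⟨hu, u', h1, h2⟩
    refine ⟨AEEqFun.Integrable.smul hu, _, ?_, h2.smul c⟩
    filter_upwards [AEEqFun.coeFn_smul c u, h1] with x hx hx1
    rw [hx, Pi.smul_apply, hx1]

/-- The three families of finite elements. -/
inductive FEKind
  | lagrange
  | raviartThomas
  | discontinuous

/-- The number `μ` of components of the finite element functions. -/
def FEKind.valueDim (d : ℕ) : FEKind → ℕ
  | .lagrange => 1
  | .raviartThomas => d
  | .discontinuous => 1

/-- The finite element spaces `S_k`, `RT_{k-1}` and `S⁰_k` (for `1 ≤ k`). -/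
def FEKind.space {d : ℕ} (K : FEKind) (k : ℕ) (Ω : Set (Fin d → ℝ))
    (𝒯 : Finset (Finset (Fin d → ℝ))) : Submodule ℝ (AEFun Ω (K.valueDim d)) :=
  match K with
  | .lagrange => lagrangeSpace k Ω 𝒯
  | .raviartThomas => raviartThomasSpace (k - 1) Ω 𝒯
  | .discontinuous => discontinuousSpace k Ω 𝒯

/-- `v` is supported on `s` elements of the mesh: it vanishes a.e. on all elements outside some
set of `s` elements. -/
def SupportedOn {d μ : ℕ} {Ω : Set (Fin d → ℝ)} (𝒯 : Finset (Finset (Fin d → ℝ)))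
    (v : AEFun Ω μ) (s : ℕ) : Prop :=
  ∃ 𝒮 ⊆ 𝒯, 𝒮.card = s ∧
    ∀ V ∈ 𝒯, V ∉ 𝒮 → ∀ᵐ x ∂(volume.restrict Ω), x ∈ openHull V → v x = 0

end FEMNet

end

noncomputable section

namespace FEMNet

/-! ### Networks with layers indexed by finite types -/

/-! Almost everywhere, a function of any of the three spaces is a polynomial of degree at most `k`
in each component on each element, because element boundaries are null sets. Hence a component of `θ
i` is a sum of `s i` terms "polynomial times indicator of an open simplex", and it suffices to
emulate one such term with size `C (k+1)^d`, `C` independent of `d`.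

The polynomial is split into ridge functions. One family of directions, as many as there are
monomials of degree `k`, has the property that for every `j ≤ k` the `j`-th powers of the
corresponding linear forms span all monomials of degree `j` (`exists_directions`). One extra
constant form `1` carries the constant term, so the polynomial is a sum of univariate polynomials
without constant term, evaluated at affine forms `y` (`exists_ridge`).

The indicator is applied to `y` and not to the polynomial. BiSU neurons test the `d + 1` barycentric
inequalities, and a ReLU neuron with a large bias annihilates `y` unless all of them hold
(`relu_mask`). A univariate polynomial without constant term sends the annihilated argument to `0`,
so no multiplication by the indicator is needed.

The univariate polynomial is evaluated by Estrin's scheme: neighbouring coefficients are merged into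
`v (2i) + v (2i+1) y`, `y` is replaced by `y^2`, and the number of coefficients halves. The products
come from squares by polarization, and identity and square are exact combinations of boundedly many
`reluPow r` neurons (`exists_quadNeurons`). The depth is logarithmic in `k` and the size linear in
`k`.

One ridge network costs `O(d^2 + k)`, and there are at most `d ((k+1)/2)^(d-1) + 1` of them per
element and component (`card_finsuppAntidiag_mul_le`). The factor `2^(1-d)` absorbs all powers of
`d`, whence `succ_numDirections_mul_le`.

All these networks run in parallel. Only the output weights distinguish `Φ` from the `Φ^v`: they
select basis components or weight them by the coordinates of `v`. Each ridge network feeds at most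
one output in either case, so the size bound is the same. -/

/-- A hidden layer: a finite type of neurons with their activation functions. -/
structure Layer where
  ι : Type
  [fintype : Fintype ι]
  act : ι → ℝ → ℝ

attribute [instance] Layer.fintype

/-- Networks with hidden layers `W`, inputs indexed by `α` and outputs indexed by `β`. -/
def INet : List Layer → Type → Type → Type
  | [], α, β => (β → α → ℝ) × (β → ℝ)
  | L :: W, α, β => (L.ι → α → ℝ) × (L.ι → ℝ) × INet W L.ι β

/-- The affine map with matrix `A` and bias `b`. -/
def affine {α β : Type} [Fintype α] (A : β → α → ℝ) (b : β → ℝ) (x : α → ℝ) (i : β) : ℝ :=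
  ∑ j, A i j * x j + b i

/-- The realization of an indexed network. -/
def INet.realize : (W : List Layer) → {α β : Type} → [Fintype α] → INet W α β →
    (α → ℝ) → β → ℝ
  | [], _, _, _, Φ, x => affine Φ.1 Φ.2 x
  | L :: W, _, _, _, Φ, x => INet.realize W Φ.2.2 fun i => L.act i (affine Φ.1 Φ.2.1 x i)

/-! ### Counting nonzero entries. -/

/-- The indicator of being nonzero. -/
def nz (x : ℝ) : ℕ := if x = 0 then 0 else 1

@[simp] theorem nz_zero : nz 0 = 0 := by simp [nz]

theorem nz_le_one (x : ℝ) : nz x ≤ 1 := by unfold nz; split_ifs <;> simp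

theorem nz_mul (x y : ℝ) : nz (x * y) = nz x * nz y := by
  unfold nz
  by_cases hx : x = 0 <;> by_cases hy : y = 0 <;> simp [hx, hy]

theorem nz_add_le (x y : ℝ) : nz (x + y) ≤ nz x + nz y := by
  unfold nz
  by_cases hx : x = 0 <;> by_cases hy : y = 0 <;> simp [hx, hy]
  split_ifs <;> simp

theorem nz_sum_le {ι : Type*} (s : Finset ι) (f : ι → ℝ) : nz (∑ i ∈ s, f i) ≤ ∑ i ∈ s, nz (f i) :=
  Finset.le_sum_of_subadditive _ nz_zero.le nz_add_le s f

/-- The number of nonzero entries of a matrix. -/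
def nnz {α β : Type} [Fintype α] [Fintype β] (A : β → α → ℝ) : ℕ := ∑ i, ∑ j, nz (A i j)

/-- The number of nonzero entries of a vector. -/
def vnz {β : Type} [Fintype β] (b : β → ℝ) : ℕ := ∑ i, nz (b i)

theorem vnz_le_card {β : Type} [Fintype β] (b : β → ℝ) : vnz b ≤ Fintype.card β := by
  simpa [vnz] using Finset.sum_le_card_nsmul Finset.univ (fun i => nz (b i)) 1
    fun i _ => nz_le_one (b i)

theorem nnz_le_of_rows {α β : Type} [Fintype α] [Fintype β] (A : β → α → ℝ) (c : ℕ)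
    (h : ∀ i, vnz (A i) ≤ c) : nnz A ≤ Fintype.card β * c := by
  simpa [nnz, vnz] using Finset.sum_le_card_nsmul Finset.univ (fun i => vnz (A i)) c fun i _ => h i

theorem nnz_le_card_mul {α β : Type} [Fintype α] [Fintype β] (A : β → α → ℝ) :
    nnz A ≤ Fintype.card β * Fintype.card α :=
  nnz_le_of_rows A _ fun i => vnz_le_card (A i)

theorem vnz_single_le {β : Type} [Fintype β] [DecidableEq β] (i : β) (c : ℝ) :
    vnz (Pi.single i c : β → ℝ) ≤ 1 := by
  unfold vnz
  rw [Finset.sum_eq_single i] <;> simp +contextual [nz_le_one]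

theorem vnz_add_le {β : Type} [Fintype β] (f g : β → ℝ) :
    vnz (fun i => f i + g i) ≤ vnz f + vnz g := by
  unfold vnz
  rw [← Finset.sum_add_distrib]
  exact Finset.sum_le_sum fun i _ => nz_add_le _ _

/-- Only the rows of `A` picked out by nonzero entries of `a` contribute, which controls fill-in
when sparse affine maps are composed. -/
theorem vnz_sum_mul_le {β γ : Type} [Fintype β] [Fintype γ] (a : γ → ℝ) (A : γ → β → ℝ) (c : ℕ)
    (h : ∀ i, vnz (A i) ≤ c) : vnz (fun j => ∑ i, a i * A i j) ≤ vnz a * c := by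
  calc vnz (fun j => ∑ i, a i * A i j) ≤ ∑ j, ∑ i, nz (a i) * nz (A i j) := by
        refine Finset.sum_le_sum fun j _ => (nz_sum_le _ _).trans (Finset.sum_le_sum fun i _ => ?_)
        rw [nz_mul]
    _ = ∑ i, nz (a i) * vnz (A i) := by
        rw [Finset.sum_comm]
        simp only [vnz, Finset.mul_sum]
    _ ≤ ∑ i, nz (a i) * c := by gcongr with i; exact h i
    _ = vnz a * c := by rw [vnz, Finset.sum_mul]

/-- The size of an indexed network. -/
def INet.size : (W : List Layer) → {α β : Type} → [Fintype α] → [Fintype β] → INet W α β → ℕ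
  | [], _, _, _, _, Φ => nnz Φ.1 + vnz Φ.2
  | _ :: W, _, _, _, _, Φ => nnz Φ.1 + vnz Φ.2.1 + INet.size W Φ.2.2

/-! ### Precomposition with affine maps -/

/-- The network `Φ` after the affine map with matrix `A` and bias `b`. -/
def INet.precomp : (W : List Layer) → {α γ β : Type} → [Fintype γ] → (γ → α → ℝ) → (γ → ℝ) →
    INet W γ β → INet W α β
  | [], _, _, _, _, A, b, Φ => (fun i j => ∑ k, Φ.1 i k * A k j, affine Φ.1 Φ.2 b)
  | _ :: _, _, _, _, _, A, b, Φ => (fun i j => ∑ k, Φ.1 i k * A k j, affine Φ.1 Φ.2.1 b, Φ.2.2)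

theorem affine_affine {α γ β : Type} [Fintype α] [Fintype γ] (A : γ → α → ℝ) (b : γ → ℝ)
    (B : β → γ → ℝ) (c : β → ℝ) (x : α → ℝ) :
    affine (fun i j => ∑ k, B i k * A k j) (affine B c b) x = affine B c (affine A b x) := by
  ext i
  simp only [affine, Finset.sum_mul, mul_add, Finset.sum_add_distrib, Finset.mul_sum]
  rw [Finset.sum_comm]
  simp only [mul_assoc, add_assoc]

theorem INet.realize_precomp (W : List Layer) {α γ β : Type} [Fintype α] [Fintype γ]
    (A : γ → α → ℝ) (b : γ → ℝ) (Φ : INet W γ β) (x : α → ℝ) :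
    (Φ.precomp W A b).realize W x = Φ.realize W (affine A b x) := by
  cases W with
  | nil => exact affine_affine A b Φ.1 Φ.2 x
  | cons L W =>
    change INet.realize W Φ.2.2 _ = INet.realize W Φ.2.2 _
    congr 1
    ext i
    rw [INet.precomp, affine_affine]

/-- The matrix of the first layer has at most `c` nonzero entries in each row, and at most `m`
rows. -/
def INet.FirstLayerSparse (c m : ℕ) : (W : List Layer) → {α β : Type} → [Fintype α] → [Fintype β] →
    INet W α β → Prop
  | [], _, β, _, _, Φ => Fintype.card β ≤ m ∧ ∀ i, vnz (Φ.1 i) ≤ c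
  | L :: _, _, _, _, _, Φ => Fintype.card L.ι ≤ m ∧ ∀ i, vnz (Φ.1 i) ≤ c

/-- Composing affine maps costs no depth and alters only the first layer: each of its at most `m`
rows then has at most `c * a` nonzero weights and one bias. -/
theorem INet.size_precomp_le {c m : ℕ} (W : List Layer) {α γ β : Type} [Fintype α] [Fintype γ]
    [Fintype β] (A : γ → α → ℝ) (b : γ → ℝ) (Φ : INet W γ β) (a : ℕ) (hA : ∀ i, vnz (A i) ≤ a)
    (hΦ : Φ.FirstLayerSparse c m W) :
    (Φ.precomp W A b).size W ≤ m * (c * a + 1) + Φ.size W := by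
  have key : ∀ {δ : Type} [Fintype δ] (B : δ → γ → ℝ) (b' : δ → ℝ), Fintype.card δ ≤ m →
      (∀ i, vnz (B i) ≤ c) → nnz (fun i j => ∑ k, B i k * A k j) + vnz b' ≤ m * (c * a + 1) := by
    intro δ _ B b' h1 h2
    have h3 : nnz (fun i j => ∑ k, B i k * A k j) ≤ Fintype.card δ * (c * a) :=
      nnz_le_of_rows _ _ fun i => (vnz_sum_mul_le (B i) A a hA).trans (by gcongr; exact h2 i)
    calc _ ≤ Fintype.card δ * (c * a) + Fintype.card δ := add_le_add h3 (vnz_le_card _)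
      _ = Fintype.card δ * (c * a + 1) := by ring
      _ ≤ _ := by gcongr
  cases W with
  | nil => exact (key Φ.1 _ hΦ.1 hΦ.2).trans (Nat.le_add_right _ _)
  | cons L W =>
    have := key Φ.1 (affine Φ.1 Φ.2.1 b) hΦ.1 hΦ.2
    simp only [INet.size, INet.precomp]
    omega

/-! ### Parallel networks -/

/-- `Q` copies of a layer. -/
def Layer.copies (Q : Type) [Fintype Q] (L : Layer) : Layer where
  ι := Q × L.ι
  act q := L.act q.2

/-- The weighted sums, with weights `G`, of the scalar networks `Φ q`, which run in parallel on
separate inputs. -/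
def INet.par {Q : Type} [Fintype Q] [DecidableEq Q] {β : Type} (G : β → Q → ℝ) :
    (W : List Layer) → {α : Type} → (Q → INet W α Unit) → INet (W.map (Layer.copies Q)) (Q × α) β
  | [], _, Φ => (fun i q => G i q.1 * (Φ q.1).1 () q.2, fun i => ∑ q, G i q * (Φ q).2 ())
  | _ :: W, _, Φ => (fun i j => if i.1 = j.1 then (Φ i.1).1 i.2 j.2 else 0,
      fun i => (Φ i.1).2.1 i.2, INet.par G W fun q => (Φ q).2.2)

/-- The weighted sums, with weights `G`, of the scalar networks `Φ q`, which run in parallel on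
the same input. -/
def INet.parShared {Q : Type} [Fintype Q] [DecidableEq Q] {β : Type} (G : β → Q → ℝ) (L : Layer)
    (W : List Layer) {α : Type} (Φ : Q → INet (L :: W) α Unit) :
    INet ((L :: W).map (Layer.copies Q)) α β :=
  (fun i j => (Φ i.1).1 i.2 j, fun i => (Φ i.1).2.1 i.2, INet.par G W fun q => (Φ q).2.2)

theorem INet.realize_par {Q : Type} [Fintype Q] [DecidableEq Q] {β : Type} (G : β → Q → ℝ)
    (W : List Layer) {α : Type} [Fintype α] (Φ : Q → INet W α Unit) (x : Q × α → ℝ) (i : β) :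
    (INet.par G W Φ).realize _ x i = ∑ q, G i q * (Φ q).realize W (fun p => x (q, p)) () := by
  induction W generalizing α with
  | nil =>
    change affine _ _ x i = _
    simp only [affine, INet.realize, Fintype.sum_prod_type, mul_add, Finset.sum_add_distrib,
      Finset.mul_sum, INet.par, mul_assoc]
  | cons L W ih =>
    change INet.realize (W.map (Layer.copies Q)) (INet.par G W fun q => (Φ q).2.2) _ i = _
    refine (ih _ _).trans (Finset.sum_congr rfl fun q _ => ?_)
    congr 2
    funext p
    change L.act p _ = L.act p _
    congr 1
    simp only [affine, INet.par, Fintype.sum_prod_type]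
    rw [Finset.sum_eq_single q]
    · simp
    · intro q' _ hq'
      simp [hq'.symm]
    · simp

theorem INet.realize_parShared {Q : Type} [Fintype Q] [DecidableEq Q] {β : Type} (G : β → Q → ℝ)
    (L : Layer) (W : List Layer) {α : Type} [Fintype α] (Φ : Q → INet (L :: W) α Unit) (x : α → ℝ)
    (i : β) :
    (INet.parShared G L W Φ).realize _ x i = ∑ q, G i q * (Φ q).realize (L :: W) x () :=
  INet.realize_par G W _ _ i

/-- The hidden matrices are block diagonal, so their sizes add up. Since every column of `G` has at
most one nonzero entry, the output weights of each `Φ q` are copied into at most one row. -/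
theorem INet.size_par_le {Q : Type} [Fintype Q] [DecidableEq Q] {β : Type} [Fintype β]
    (G : β → Q → ℝ) (hG : ∀ q, vnz (fun i => G i q) ≤ 1) (W : List Layer) {α : Type} [Fintype α]
    (Φ : Q → INet W α Unit) : (INet.par G W Φ).size _ ≤ ∑ q, (Φ q).size W := by
  induction W generalizing α with
  | nil =>
    have h1 : nnz (fun (i : β) (q : Q × α) => G i q.1 * (Φ q.1).1 () q.2) ≤
        ∑ q, nnz (Φ q).1 := by
      simp only [nnz, Fintype.sum_prod_type, nz_mul]
      rw [Finset.sum_comm]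
      refine Finset.sum_le_sum fun q _ => ?_
      simp only [← Finset.mul_sum]
      rw [← Finset.sum_mul]
      simpa [vnz] using Nat.mul_le_mul_right (∑ j, nz ((Φ q).1 () j)) (hG q)
    have h2 : vnz (fun i : β => ∑ q, G i q * (Φ q).2 ()) ≤ ∑ q, vnz (Φ q).2 := by
      calc _ ≤ ∑ i, ∑ q, nz (G i q) * nz ((Φ q).2 ()) := by
            refine Finset.sum_le_sum fun i _ => (nz_sum_le _ _).trans
              (Finset.sum_le_sum fun q _ => ?_)
            rw [nz_mul]
        _ ≤ _ := by
            rw [Finset.sum_comm]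
            refine Finset.sum_le_sum fun q _ => ?_
            rw [← Finset.sum_mul]
            simpa [vnz] using Nat.mul_le_mul_right (nz ((Φ q).2 ())) (hG q)
    have := add_le_add h1 h2
    rw [← Finset.sum_add_distrib] at this
    exact this
  | cons L W ih =>
    have h1 : nnz (fun (i : Q × L.ι) (j : Q × α) => if i.1 = j.1 then (Φ i.1).1 i.2 j.2 else 0) ≤
        ∑ q, nnz (Φ q).1 := by
      simp only [nnz, Fintype.sum_prod_type]
      refine Finset.sum_le_sum fun q _ => Finset.sum_le_sum fun i _ => ?_
      rw [Finset.sum_eq_single q]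
      · simp
      · intro q' _ hq'
        simp [hq'.symm]
      · simp
    have h2 : vnz (fun i : Q × L.ι => (Φ i.1).2.1 i.2) ≤ ∑ q, vnz (Φ q).2.1 := by
      simp only [vnz, Fintype.sum_prod_type, le_refl]
    have := add_le_add (add_le_add h1 h2) (ih fun q => (Φ q).2.2)
    rw [← Finset.sum_add_distrib, ← Finset.sum_add_distrib] at this
    exact this

theorem INet.size_parShared_le {Q : Type} [Fintype Q] [DecidableEq Q] {β : Type} [Fintype β]
    (G : β → Q → ℝ) (hG : ∀ q, vnz (fun i => G i q) ≤ 1) (L : Layer) (W : List Layer) {α : Type}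
    [Fintype α] (Φ : Q → INet (L :: W) α Unit) :
    (INet.parShared G L W Φ).size _ ≤ ∑ q, (Φ q).size (L :: W) := by
  have h1 : nnz (fun (i : Q × L.ι) (j : α) => (Φ i.1).1 i.2 j) ≤ ∑ q, nnz (Φ q).1 := by
    simp only [nnz, Fintype.sum_prod_type, le_refl]
  have h2 : vnz (fun i : Q × L.ι => (Φ i.1).2.1 i.2) ≤ ∑ q, vnz (Φ q).2.1 := by
    simp only [vnz, Fintype.sum_prod_type, le_refl]
  have := add_le_add (add_le_add h1 h2) (INet.size_par_le G hG W fun q => (Φ q).2.2)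
  rw [← Finset.sum_add_distrib, ← Finset.sum_add_distrib] at this
  exact this

/-! ### Conversion to networks -/

/-- The list of the activation functions of a layer. -/
def Layer.acts (L : Layer) : List (ℝ → ℝ) :=
  List.ofFn fun i => L.act ((Fintype.equivFin L.ι).symm i)

/-- The network obtained from an indexed network by numbering the neurons. -/
def INet.toNet : (W : List Layer) → (∀ L ∈ W, 0 < Fintype.card L.ι) → {α β : Type} → {m n : ℕ} →
    α ≃ Fin m → β ≃ Fin n → INet W α β → Net m n
  | [], _, _, _, _, _, e, f, Φ => .out (Matrix.of fun i j => Φ.1 (f.symm i) (e.symm j)) (Φ.2 ∘ f.symm)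
  | L :: W, h, _, _, _, _, e, f, Φ =>
    .hidden (h L List.mem_cons_self)
      (Matrix.of fun i j => Φ.1 ((Fintype.equivFin L.ι).symm i) (e.symm j))
      (Φ.2.1 ∘ (Fintype.equivFin L.ι).symm) (fun i => L.act ((Fintype.equivFin L.ι).symm i))
      (INet.toNet W (fun L' h' => h L' (List.mem_cons_of_mem _ h')) (Fintype.equivFin L.ι) f Φ.2.2)

theorem affine_reindex {α β : Type} [Fintype α] {m n : ℕ} (e : α ≃ Fin m) (f : β ≃ Fin n)
    (A : β → α → ℝ) (b : β → ℝ) (x : Fin m → ℝ) :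
    (Matrix.of fun i j => A (f.symm i) (e.symm j)) *ᵥ x + b ∘ f.symm =
      fun i => affine A b (x ∘ e) (f.symm i) := by
  ext i
  simp only [Pi.add_apply, Matrix.mulVec, dotProduct, Matrix.of_apply, affine, Function.comp_apply]
  rw [← e.sum_comp]
  simp

theorem INet.realize_toNet (W : List Layer) (h : ∀ L ∈ W, 0 < Fintype.card L.ι) {α β : Type}
    [Fintype α] {m n : ℕ} (e : α ≃ Fin m) (f : β ≃ Fin n) (Φ : INet W α β) (x : Fin m → ℝ) :
    (Φ.toNet W h e f).realize x = fun i => Φ.realize W (x ∘ e) (f.symm i) := by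
  induction W generalizing α m with
  | nil => exact affine_reindex e f Φ.1 Φ.2 x
  | cons L W ih =>
    rw [INet.toNet, Net.realize, affine_reindex, ih]
    ext i
    simp only [INet.realize]
    congr 1
    ext p
    simp

theorem layerSize_reindex {α β : Type} [Fintype α] [Fintype β] {m n : ℕ} (e : α ≃ Fin m)
    (f : β ≃ Fin n) (A : β → α → ℝ) (b : β → ℝ) :
    layerSize (Matrix.of fun i j => A (f.symm i) (e.symm j)) (b ∘ f.symm) = nnz A + vnz b := by
  classical
  unfold layerSize nnz vnz
  congr 1
  · rw [Set.ncard_eq_toFinset_card', Set.toFinset_ofPred, Finset.card_filter, Fintype.sum_prod_type,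
      ← f.sum_comp]
    refine Finset.sum_congr rfl fun i _ => ?_
    rw [← e.sum_comp]
    refine Finset.sum_congr rfl fun j _ => ?_
    simp [nz]
  · rw [Set.ncard_eq_toFinset_card', Set.toFinset_ofPred, Finset.card_filter, ← f.sum_comp]
    refine Finset.sum_congr rfl fun i _ => ?_
    simp [nz]

theorem INet.size_toNet (W : List Layer) (h : ∀ L ∈ W, 0 < Fintype.card L.ι) {α β : Type}
    [Fintype α] [Fintype β] {m n : ℕ} (e : α ≃ Fin m) (f : β ≃ Fin n) (Φ : INet W α β) :
    (Φ.toNet W h e f).size = Φ.size W := by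
  induction W generalizing α m with
  | nil => exact layerSize_reindex e f Φ.1 Φ.2
  | cons L W ih => rw [INet.toNet, Net.size, layerSize_reindex, ih, INet.size]

theorem INet.activations_toNet (W : List Layer) (h : ∀ L ∈ W, 0 < Fintype.card L.ι) {α β : Type}
    {m n : ℕ} (e : α ≃ Fin m) (f : β ≃ Fin n) (Φ : INet W α β) :
    (Φ.toNet W h e f).activations = W.map Layer.acts := by
  induction W generalizing α m with
  | nil => rfl
  | cons L W ih => rw [INet.toNet, Net.activations, ih, List.map_cons, Layer.acts]

/-- Together with `Net.depth_eq`, this reduces every claim about widths and depth to a claim about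
the lists of activation functions. -/
theorem Net.layerDims_eq {m n : ℕ} (Φ : Net m n) :
    Φ.layerDims = m :: (Φ.activations.map List.length ++ [n]) := by
  induction Φ with
  | out A b => rfl
  | hidden hp A b ϱ Φ ih => simp [Net.layerDims, Net.activations, ih]

theorem Net.depth_eq {m n : ℕ} (Φ : Net m n) : Φ.depth = Φ.activations.length + 1 := by
  induction Φ with
  | out A b => rfl
  | hidden hp A b ϱ Φ ih => simp [Net.depth, Net.activations, ih]

/-- The weights `G` enter only the output layer of `INet.par`; this is what makes the hidden layers
independent of `v`. -/
theorem INet.hiddenLayers_toNet_par {Q : Type} [Fintype Q] [DecidableEq Q] {β β' : Type}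
    (G : β → Q → ℝ) (G' : β' → Q → ℝ) (W : List Layer)
    (h : ∀ L ∈ W.map (Layer.copies Q), 0 < Fintype.card L.ι) {α : Type} {m n n' : ℕ}
    (e : Q × α ≃ Fin m) (f : β ≃ Fin n) (f' : β' ≃ Fin n') (Φ : Q → INet W α Unit) :
    ((INet.par G W Φ).toNet _ h e f).hiddenLayers =
      ((INet.par G' W Φ).toNet _ h e f').hiddenLayers := by
  induction W generalizing α m with
  | nil => rfl
  | cons L W ih =>
    exact congrArg (List.cons _) (ih (fun L' h' => h L' (List.mem_cons_of_mem _ h'))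
      (Fintype.equivFin _) fun q => (Φ q).2.2)

theorem INet.hiddenLayers_toNet_parShared {Q : Type} [Fintype Q] [DecidableEq Q] {β β' : Type}
    (G : β → Q → ℝ) (G' : β' → Q → ℝ) (L : Layer) (W : List Layer)
    (h : ∀ L' ∈ (L :: W).map (Layer.copies Q), 0 < Fintype.card L'.ι) {α : Type} {m n n' : ℕ}
    (e : α ≃ Fin m) (f : β ≃ Fin n) (f' : β' ≃ Fin n') (Φ : Q → INet (L :: W) α Unit) :
    ((INet.parShared G L W Φ).toNet _ h e f).hiddenLayers =
      ((INet.parShared G' L W Φ).toNet _ h e f').hiddenLayers :=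
  congrArg (List.cons _) (INet.hiddenLayers_toNet_par G G' W
    (fun L' h' => h L' (List.mem_cons_of_mem _ h')) (Fintype.equivFin _) f f' fun q => (Φ q).2.2)

/-! ### Powers from rectified power units -/

/-- Expanding `(z + i)^r` binomially, the coefficients `c` must have prescribed moments at the nodes
`0, …, r`: zero except for the moment of order `r - m`, which cancels the binomial coefficient. The
Vandermonde matrix of the distinct nodes is invertible. -/
theorem exists_sum_shifted_pow (r m : ℕ) (hm : m ≤ r) :
    ∃ c : Fin (r + 1) → ℝ, ∀ z : ℝ, ∑ i, c i * (z + (i : ℕ)) ^ r = z ^ m := by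
  set V : Matrix (Fin (r + 1)) (Fin (r + 1)) ℝ := Matrix.vandermonde fun i => ((i : ℕ) : ℝ) with hV
  have hdet : IsUnit V.det := by
    rw [isUnit_iff_ne_zero, hV, Matrix.det_vandermonde_ne_zero_iff]
    intro i j hij
    have h : ((i : ℕ) : ℝ) = (j : ℕ) := hij
    exact Fin.ext (by exact_mod_cast h)
  set e : Fin (r + 1) → ℝ := Pi.single (Fin.ofNat (r + 1) (r - m)) ((r.choose (r - m) : ℝ)⁻¹)
  refine ⟨e ᵥ* V⁻¹, fun z => ?_⟩
  have hc : (e ᵥ* V⁻¹) ᵥ* V = e := by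
    rw [Matrix.vecMul_vecMul, Matrix.nonsing_inv_mul V hdet, Matrix.vecMul_one]
  set c := e ᵥ* V⁻¹
  have hc' : ∀ j : Fin (r + 1), ∑ i, c i * ((i : ℕ) : ℝ) ^ (j : ℕ) = e j := by
    intro j
    rw [← hc]
    simp [Matrix.vecMul, dotProduct, hV, Matrix.vandermonde_apply]
  calc ∑ i, c i * (z + (i : ℕ)) ^ r
      = ∑ i, ∑ j : Fin (r + 1), c i * (((i : ℕ) : ℝ) ^ (j : ℕ) * z ^ (r - j) * r.choose j) := by
        refine Finset.sum_congr rfl fun i _ => ?_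
        rw [add_comm, add_pow, Finset.mul_sum, Finset.sum_range]
    _ = ∑ j : Fin (r + 1), e j * (z ^ (r - j) * r.choose j) := by
        rw [Finset.sum_comm]
        refine Finset.sum_congr rfl fun j _ => ?_
        rw [← hc', Finset.sum_mul]
        exact Finset.sum_congr rfl fun i _ => by ring
    _ = z ^ m := by
        -- `Fin.ofNat` reduces modulo `r + 1`, which is harmless because `r - m ≤ r`.
        have hv : ((Fin.ofNat (r + 1) (r - m) : Fin (r + 1)) : ℕ) = r - m :=
          Nat.mod_eq_of_lt (by omega)
        rw [Finset.sum_eq_single (Fin.ofNat (r + 1) (r - m))]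
        · have hne : (r.choose (r - m) : ℝ) ≠ 0 := by
            exact_mod_cast (Nat.choose_pos (Nat.sub_le r m)).ne'
          simp only [e, Pi.single_eq_same, hv]
          rw [Nat.sub_sub_self hm]
          field_simp
        · intro j _ hj
          rw [show e j = 0 from Pi.single_eq_of_ne hj _, zero_mul]
        · simp

theorem pow_eq_reluPow {r : ℕ} (hr : r ≠ 0) (x : ℝ) :
    x ^ r = reluPow r x + (-1) ^ r * reluPow r (-x) := by
  unfold reluPow relu
  rcases le_total 0 x with h | h
  · rw [max_eq_right h, max_eq_left (by linarith), zero_pow hr]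
    ring
  · rw [max_eq_left h, max_eq_right (by linarith), zero_pow hr, ← mul_pow]
    ring

/-- A family of neurons with activation `reluPow r` from which a real number and its square can be
recovered linearly. -/
structure QuadNeurons (r : ℕ) where
  ι : Type
  [fintype : Fintype ι]
  nonempty : Nonempty ι
  weight : ι → ℝ
  bias : ι → ℝ
  coeffId : ι → ℝ
  coeffSq : ι → ℝ
  sum_id : ∀ z, ∑ i, coeffId i * reluPow r (weight i * z + bias i) = z
  sum_sq : ∀ z, ∑ i, coeffSq i * reluPow r (weight i * z + bias i) = z ^ 2

attribute [instance] QuadNeurons.fintype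

theorem exists_quadNeurons {r : ℕ} (hr : 2 ≤ r) : Nonempty (QuadNeurons r) := by
  obtain ⟨c, hc⟩ := exists_sum_shifted_pow r 1 (by omega)
  obtain ⟨c', hc'⟩ := exists_sum_shifted_pow r 2 hr
  have key : ∀ (a : Fin (r + 1) → ℝ) (z : ℝ), ∑ q : Fin (r + 1) × Bool,
      (if q.2 then a q.1 else (-1) ^ r * a q.1) *
        reluPow r ((if q.2 then 1 else -1) * z + (if q.2 then 1 else -1) * (q.1 : ℕ)) =
      ∑ i, a i * (z + (i : ℕ)) ^ r := by
    intro a z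
    rw [Fintype.sum_prod_type]
    refine Finset.sum_congr rfl fun i _ => ?_
    rw [Fintype.sum_bool, pow_eq_reluPow (by omega) (z + (i : ℕ))]
    simp only [if_true, Bool.false_eq_true, if_false, one_mul]
    rw [show (-1 : ℝ) * z + -1 * ((i : ℕ) : ℝ) = -(z + (i : ℕ)) by ring]
    ring
  exact ⟨{ ι := Fin (r + 1) × Bool
           nonempty := inferInstance
           weight := fun q => if q.2 then 1 else -1
           bias := fun q => (if q.2 then 1 else -1) * (q.1 : ℕ)
           coeffId := fun q => if q.2 then c q.1 else (-1) ^ r * c q.1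
           coeffSq := fun q => if q.2 then c' q.1 else (-1) ^ r * c' q.1
           sum_id := fun z => by rw [key, hc, pow_one]
           sum_sq := fun z => by rw [key, hc'] }⟩

/-! ### Polynomial evaluation in logarithmic depth -/

/-- The linear forms whose squares are needed to combine neighbouring coefficients
`v (2 i)`, `v (2 i + 1)` (the indices `some _`) with the variable `y` (the index `none`). -/
def pairForm (t : ℕ) : Option (Fin (2 ^ t) × Fin 3) → Option (Fin (2 ^ (t + 1))) → ℝ
  | none => Pi.single none 1
  | some (i, j) => fun s =>
      (Pi.single (some (finProdFinEquiv (i, if j = 0 then 0 else 1))) 1 :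
        Option (Fin (2 ^ (t + 1))) → ℝ) s +
      (Pi.single none (if j = 0 then 0 else if j = 1 then 1 else -1) :
        Option (Fin (2 ^ (t + 1))) → ℝ) s

/-- The hidden layers of the network `estrin`. -/
def estrinLayers {r : ℕ} (F : QuadNeurons r) : ℕ → List Layer
  | 0 => []
  | t + 1 => ⟨Option (Fin (2 ^ t) × Fin 3) × F.ι, fun _ => reluPow r⟩ :: estrinLayers F t

/-- The coefficients of the linear map which recovers `v (2 i) + v (2 i + 1) * y` and `y ^ 2` from
the neurons. -/
def pairOut {r : ℕ} (F : QuadNeurons r) (t : ℕ) : Option (Fin (2 ^ t)) →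
    Option (Fin (2 ^ t) × Fin 3) × F.ι → ℝ
  | none => fun q => if q.1 = none then F.coeffSq q.2 else 0
  | some i => fun q => if q.1 = some (i, 0) then F.coeffId q.2
      else if q.1 = some (i, 1) then F.coeffSq q.2 / 4
      else if q.1 = some (i, 2) then -(F.coeffSq q.2 / 4) else 0

/-- The network which evaluates the polynomial with coefficients `v` at `y` by Estrin's scheme. The
input consists of `v` (the indices `some _`) and of `y` (the index `none`). -/
def estrin {r : ℕ} (F : QuadNeurons r) : (t : ℕ) →
    INet (estrinLayers F t) (Option (Fin (2 ^ t))) Unit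
  | 0 => (fun _ => Pi.single (some 0) 1, 0)
  | t + 1 => (fun q s => F.weight q.2 * pairForm t q.1 s, fun q => F.bias q.2,
      INet.precomp _ (pairOut F t) 0 (estrin F t))

theorem sum_option_prod_fin_three {n : ℕ} {ι : Type} [Fintype ι]
    (f : Option (Fin n × Fin 3) × ι → ℝ) :
    ∑ q, f q = ∑ h, f (none, h) + ∑ i, ∑ j, ∑ h, f (some (i, j), h) := by
  rw [Fintype.sum_prod_type, Fintype.sum_option, Fintype.sum_prod_type]

theorem sum_pairForm (t : ℕ) (x : Option (Fin (2 ^ (t + 1))) → ℝ)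
    (q : Option (Fin (2 ^ t) × Fin 3)) :
    ∑ s, pairForm t q s * x s = match q with
      | none => x none
      | some (i, j) => x (some (finProdFinEquiv (i, if j = 0 then 0 else 1))) +
          (if j = 0 then 0 else if j = 1 then 1 else -1) * x none := by
  rcases q with _ | ⟨i, j⟩
  · simp [pairForm, Pi.single_apply]
  · simp only [pairForm, add_mul, Finset.sum_add_distrib]
    simp [Pi.single_apply]

/-- With `z (some (i, 1)) = v (2i+1) + y` and `z (some (i, 2)) = v (2i+1) - y`, the difference of
the quarter squares is the product `v (2i+1) * y`. -/
theorem sum_pairOut {r : ℕ} (F : QuadNeurons r) (t : ℕ) (z : Option (Fin (2 ^ t) × Fin 3) → ℝ)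
    (s : Option (Fin (2 ^ t))) :
    ∑ q, pairOut F t s q * reluPow r (F.weight q.2 * z q.1 + F.bias q.2) = match s with
      | none => z none ^ 2
      | some i => z (some (i, 0)) + z (some (i, 1)) ^ 2 / 4 - z (some (i, 2)) ^ 2 / 4 := by
  rw [sum_option_prod_fin_three]
  rcases s with _ | i
  · simp [pairOut, F.sum_sq]
  · rw [Finset.sum_eq_single i]
    · have h1 := F.sum_id (z (some (i, 0)))
      have h2 := F.sum_sq (z (some (i, 1)))
      have h3 := F.sum_sq (z (some (i, 2)))
      simp only [pairOut, Fin.sum_univ_three]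
      simp only [reduceCtorEq, if_false, zero_mul, Finset.sum_const_zero, zero_add, if_true,
        Option.some.injEq, Prod.mk.injEq, true_and, Fin.reduceEq, neg_mul, Finset.sum_neg_distrib,
        div_mul_eq_mul_div, ← Finset.sum_div, h1, h2, h3]
      ring
    · intro j _ hj
      simp [pairOut, hj]
    · simp

/-- Even and odd indices are paired: `∑ v (2i) y^(2i) + v (2i+1) y^(2i+1) = ∑ (v (2i) + v (2i+1) y)
(y^2)^i`, a sum with half as many coefficients in the variable `y^2`. -/
theorem realize_estrin {r : ℕ} (F : QuadNeurons r) (t : ℕ) (x : Option (Fin (2 ^ t)) → ℝ) :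
    (estrin F t).realize _ x () = ∑ i : Fin (2 ^ t), x (some i) * x none ^ (i : ℕ) := by
  induction t with
  | zero =>
    change affine (fun _ : Unit => (Pi.single (some 0) 1 : Option (Fin (2 ^ 0)) → ℝ)) 0 x () = _
    rw [Fintype.sum_eq_single (0 : Fin (2 ^ 0)) (fun i hi => (hi (Fin.ext (by omega))).elim)]
    simp [affine, Pi.single_apply]
  | succ t ih =>
    change (INet.precomp _ (pairOut F t) 0 (estrin F t)).realize _ (fun q => reluPow r
      (affine (fun (q : Option (Fin (2 ^ t) × Fin 3) × F.ι) s => F.weight q.2 * pairForm t q.1 s)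
        (fun q => F.bias q.2) x q)) () = _
    rw [INet.realize_precomp, ih]
    have hz : ∀ q : Option (Fin (2 ^ t) × Fin 3) × F.ι,
        affine (fun (q : Option (Fin (2 ^ t) × Fin 3) × F.ι) s => F.weight q.2 * pairForm t q.1 s)
          (fun q => F.bias q.2) x q =
          F.weight q.2 * (∑ s, pairForm t q.1 s * x s) + F.bias q.2 := by
      intro q
      simp only [affine, Finset.mul_sum, mul_assoc]
    have hs : ∀ s, affine (pairOut F t) 0 (fun q => reluPow r
        (affine (fun (q : Option (Fin (2 ^ t) × Fin 3) × F.ι) s => F.weight q.2 * pairForm t q.1 s)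
          (fun q => F.bias q.2) x q)) s = match s with
        | none => x none ^ 2
        | some i => x (some (finProdFinEquiv (i, 0))) +
            x (some (finProdFinEquiv (i, 1))) * x none := by
      intro s
      simp only [hz]
      simp only [affine]
      rw [sum_pairOut F t (fun q => ∑ s, pairForm t q s * x s) s]
      simp only [sum_pairForm]
      rcases s with _ | i
      · simp
      · simp only [Pi.zero_apply, add_zero, if_true, zero_mul, one_ne_zero, if_false, one_mul,
          Fin.reduceEq]
        ring
    simp only [hs]
    have hsum := (finProdFinEquiv (m := 2 ^ t) (n := 2)).sum_comp
      fun i => x (some i) * x none ^ (i : ℕ)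
    refine Eq.trans ?_ hsum
    rw [Fintype.sum_prod_type]
    refine Finset.sum_congr rfl fun i _ => ?_
    rw [Fin.sum_univ_two]
    simp only [finProdFinEquiv_apply_val, Fin.val_zero, Fin.val_one, ← pow_mul]
    ring

theorem vnz_pairForm_le (t : ℕ) (q : Option (Fin (2 ^ t) × Fin 3)) : vnz (pairForm t q) ≤ 2 := by
  rcases q with _ | ⟨i, j⟩
  · exact (vnz_single_le _ _).trans one_le_two
  · exact (vnz_add_le _ _).trans (add_le_add (vnz_single_le _ _) (vnz_single_le _ _))

theorem vnz_pairOut_le {r : ℕ} (F : QuadNeurons r) (t : ℕ) (s : Option (Fin (2 ^ t))) :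
    vnz (pairOut F t s) ≤ 3 * Fintype.card F.ι := by
  have h : ∀ T : Finset (Option (Fin (2 ^ t) × Fin 3)), T.card ≤ 3 →
      (∀ q, q.1 ∉ T → pairOut F t s q = 0) → vnz (pairOut F t s) ≤ 3 * Fintype.card F.ι := by
    intro T hT h0
    calc vnz (pairOut F t s) = ∑ a, ∑ h, nz (pairOut F t s (a, h)) := by
          rw [vnz, Fintype.sum_prod_type]
      _ = ∑ a ∈ T, ∑ h, nz (pairOut F t s (a, h)) := by
          symm
          refine Finset.sum_subset (Finset.subset_univ _) fun a _ ha => ?_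
          exact Finset.sum_eq_zero fun h _ => by rw [h0 (a, h) ha, nz_zero]
      _ ≤ T.card • Fintype.card F.ι :=
          Finset.sum_le_card_nsmul _ _ _ fun a _ => vnz_le_card fun h => pairOut F t s (a, h)
      _ ≤ _ := by rw [smul_eq_mul]; gcongr
  rcases s with _ | i
  · refine h {none} (by simp) fun q hq => ?_
    simp only [Finset.mem_singleton] at hq
    simp [pairOut, hq]
  · refine h {some (i, 0), some (i, 1), some (i, 2)} Finset.card_le_three fun q hq => ?_
    simp only [Finset.mem_insert, Finset.mem_singleton, not_or] at hq
    simp [pairOut, hq]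

theorem vnz_const_mul_le {β : Type} [Fintype β] (a : ℝ) (f : β → ℝ) :
    vnz (fun i => a * f i) ≤ vnz f := by
  refine Finset.sum_le_sum fun i _ => ?_
  rw [nz_mul]
  exact (Nat.mul_le_mul_right _ (nz_le_one a)).trans (one_mul _).le

/-- Two entries per row, uniformly in `t`, let the output map of one round be absorbed into the next
at a cost proportional to `2 ^ t`. -/
theorem estrin_firstLayerSparse {r : ℕ} (F : QuadNeurons r) (t : ℕ) :
    (estrin F t).FirstLayerSparse 2 (4 * 2 ^ t * Fintype.card F.ι) _ := by
  have := F.nonempty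
  have hN : 0 < Fintype.card F.ι := Fintype.card_pos
  cases t with
  | zero =>
    refine ⟨?_, fun i => (vnz_single_le _ _).trans one_le_two⟩
    rw [Fintype.card_unit]
    omega
  | succ t =>
    refine ⟨?_, fun q => (vnz_const_mul_le _ _).trans (vnz_pairForm_le t q.1)⟩
    change Fintype.card (Option (Fin (2 ^ t) × Fin 3) × F.ι) ≤ _
    simp only [Fintype.card_prod, Fintype.card_option, Fintype.card_fin]
    gcongr
    have := Nat.one_le_two_pow (n := t)
    rw [pow_succ]
    omega

theorem size_estrin_le {r : ℕ} (F : QuadNeurons r) (t : ℕ) :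
    (estrin F t).size _ ≤ (4 * Fintype.card F.ι * (6 * Fintype.card F.ι + 1) +
      24 * Fintype.card F.ι + 1) * 2 ^ t := by
  set N := Fintype.card F.ι with hN
  induction t with
  | zero =>
    have h : (estrin F 0).size _ ≤ 1 := by
      change nnz _ + vnz _ ≤ 1
      have h1 : nnz (fun _ : Unit => (Pi.single (some 0) 1 : Option (Fin (2 ^ 0)) → ℝ)) ≤ 1 * 1 :=
        nnz_le_of_rows _ _ fun i => vnz_single_le _ _
      have h2 : vnz (0 : Unit → ℝ) = 0 := by simp [vnz]
      exact (add_le_add h1 h2.le).trans (by norm_num)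
    omega
  | succ t ih =>
    have h1 := INet.size_precomp_le _ (pairOut F t) 0 (estrin F t) _ (vnz_pairOut_le F t)
      (estrin_firstLayerSparse F t)
    obtain ⟨h2, h3⟩ := estrin_firstLayerSparse F (t + 1)
    have h4 := nnz_le_of_rows _ _ h3
    have h5 := vnz_le_card (estrin F (t + 1)).2.1
    have h6 : (estrin F (t + 1)).size _ = nnz (estrin F (t + 1)).1 + vnz (estrin F (t + 1)).2.1 +
      (INet.precomp _ (pairOut F t) 0 (estrin F t)).size _ := rfl
    rw [← hN] at h1 h2
    rw [h6]
    -- A round costs `24 N * 2 ^ t` for its layer and `4 N (6 N + 1) * 2 ^ t` for the absorbed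
    -- output map. Both are covered by doubling the bound, since the costs form a geometric series.
    calc _ ≤ 4 * 2 ^ (t + 1) * N * 2 + 4 * 2 ^ (t + 1) * N +
          (4 * 2 ^ t * N * (2 * (3 * N) + 1) +
            (4 * N * (6 * N + 1) + 24 * N + 1) * 2 ^ t) := by
          refine add_le_add (add_le_add (h4.trans ?_) (h5.trans h2)) (h1.trans ?_)
          · gcongr
          · gcongr
      _ ≤ _ + 2 ^ t := Nat.le_add_right _ _
      _ = (4 * N * (6 * N + 1) + 24 * N + 1) * 2 ^ (t + 1) := by ring

theorem length_estrinLayers {r : ℕ} (F : QuadNeurons r) (t : ℕ) :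
    (estrinLayers F t).length = t := by
  induction t with
  | zero => rfl
  | succ t ih => rw [estrinLayers, List.length_cons, ih]

theorem mem_estrinLayers {r : ℕ} (F : QuadNeurons r) (t : ℕ) :
    ∀ L ∈ estrinLayers F t, 0 < Fintype.card L.ι ∧ ∀ i, L.act i = reluPow r := by
  have := F.nonempty
  induction t with
  | zero => simp [estrinLayers]
  | succ t ih =>
    intro L hL
    rw [estrinLayers, List.mem_cons] at hL
    rcases hL with rfl | hL
    · exact ⟨Fintype.card_pos (α := Option (Fin (2 ^ t) × Fin 3) × F.ι), fun _ => rfl⟩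
    · exact ih L hL

/-! ### Localized univariate polynomials -/

/-- The sign attached to a Boolean. -/
def boolSign (s : Bool) : ℝ := if s then 1 else -1

/-- The layer which tests `d + 1` affine inequalities and passes on one number. -/
def testLayer (d : ℕ) : Layer :=
  ⟨Fin (d + 1) ⊕ Bool, Sum.elim (fun _ => bisu) fun _ => relu⟩

/-- The layer which replaces a number by `0` unless all inequalities hold. -/
def maskLayer : Layer := ⟨Bool, fun _ => relu⟩

/-- The matrix which recovers the masked number from the mask layer. -/
def maskOut (t : ℕ) : Option (Fin (2 ^ t)) → Bool → ℝ :=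
  fun k s => k.elim (boolSign s) fun _ => 0

/-- The network which computes `∑ j, c j * y ^ j`, where `y = a ⬝ᵥ x + β` if all the inequalities
`0 < Λ i ⬝ᵥ x + τ i` hold, and `y = 0` otherwise, provided that `|a ⬝ᵥ x + β| ≤ B`. -/
def maskedPoly {r : ℕ} (F : QuadNeurons r) {d t : ℕ} (Λ : Fin (d + 1) → Fin d → ℝ)
    (τ : Fin (d + 1) → ℝ) (a : Fin d → ℝ) (β B : ℝ) (c : Fin (2 ^ t) → ℝ) :
    INet (testLayer d :: maskLayer :: estrinLayers F t) (Fin d) Unit :=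
  (Sum.elim Λ (fun s j => boolSign s * a j), Sum.elim τ (fun s => boolSign s * β),
    fun (s : Bool) => Sum.elim (fun _ => B) (fun s' => if s = s' then 1 else 0), fun _ => -(B * (d + 1)),
    INet.precomp _ (maskOut t) (fun k => k.elim 0 c) (estrin F t))

theorem relu_sub_relu_neg (x : ℝ) : relu x - relu (-x) = x := by
  unfold relu
  rcases le_total 0 x with h | h
  · rw [max_eq_right h, max_eq_left (by linarith)]
    ring
  · rw [max_eq_left h, max_eq_right (by linarith)]
    ring

/-- If some inequality fails, the step functions sum to at most `d`, so the argument is at most `B d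
+ B - B (d + 1) = 0`; if all hold, the bias cancels exactly. -/
theorem relu_mask {d : ℕ} (h : Fin (d + 1) → ℝ) {y B : ℝ} (hy : |y| ≤ B) :
    relu (B * ∑ i, bisu (h i) + relu y - B * (d + 1)) = if ∀ i, 0 < h i then relu y else 0 := by
  have hB : 0 ≤ B := (abs_nonneg y).trans hy
  have hrB : relu y ≤ B := max_le hB ((le_abs_self y).trans hy)
  split_ifs with hh
  · have : ∑ i, bisu (h i) = d + 1 := by simp [bisu, hh]
    rw [this, add_sub_cancel_left]
    exact max_eq_right (le_max_left _ _)
  · push Not at hh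
    obtain ⟨i₀, hi₀⟩ := hh
    have h1 : ∑ i, bisu (h i) ≤ d := by
      rw [← Finset.add_sum_erase _ _ (Finset.mem_univ i₀), bisu, if_neg hi₀.not_gt, zero_add]
      have := Finset.sum_le_card_nsmul (Finset.univ.erase i₀) (fun i => bisu (h i)) 1
        fun i _ => by unfold bisu; split_ifs <;> norm_num
      simpa using this
    exact max_eq_left (by nlinarith)

/-- The mask acts on nonnegative numbers, so `relu y` and `relu (-y)` are masked separately and then
subtracted. The coefficients `c` enter Estrin's scheme as biases. -/
theorem realize_maskedPoly {r : ℕ} (F : QuadNeurons r) {d t : ℕ} (Λ : Fin (d + 1) → Fin d → ℝ)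
    (τ : Fin (d + 1) → ℝ) (a : Fin d → ℝ) (β B : ℝ) (c : Fin (2 ^ t) → ℝ) (x : Fin d → ℝ)
    (hx : |∑ j, a j * x j + β| ≤ B) :
    (maskedPoly F Λ τ a β B c).realize _ x () = ∑ j : Fin (2 ^ t), c j *
      (if ∀ i, 0 < affine Λ τ x i then ∑ j, a j * x j + β else 0) ^ (j : ℕ) := by
  set y := ∑ j, a j * x j + β with hy
  have h1 : ∀ s, affine (Sum.elim Λ (fun s j => boolSign s * a j) : Fin (d + 1) ⊕ Bool → _)
      (Sum.elim τ (fun s => boolSign s * β)) x (Sum.inr s) = boolSign s * y := by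
    intro s
    simp only [affine, Sum.elim_inr, mul_assoc, ← Finset.mul_sum, ← mul_add, hy]
  have hs : ∀ s, |boolSign s * y| ≤ B := by
    intro s
    cases s <;> simpa [boolSign] using hx
  have h2 : ∀ s, relu (affine (fun s => Sum.elim (fun _ : Fin (d + 1) => B)
      (fun s' : Bool => if s = s' then 1 else 0)) (fun _ => -(B * (d + 1)))
      (fun i => Sum.elim (fun _ => bisu) (fun _ => relu) i
        (affine (Sum.elim Λ (fun s j => boolSign s * a j) : Fin (d + 1) ⊕ Bool → _)
          (Sum.elim τ (fun s => boolSign s * β)) x i)) s) =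
      if ∀ i, 0 < affine Λ τ x i then relu (boolSign s * y) else 0 := by
    intro s
    rw [← relu_mask (affine Λ τ x) (hs s)]
    congr 1
    rw [affine, Fintype.sum_sum_type]
    simp only [Sum.elim_inl, Sum.elim_inr, h1, ite_mul, one_mul, zero_mul, Finset.sum_ite_eq,
      Finset.mem_univ, if_true, ← Finset.mul_sum, ← sub_eq_add_neg]
    rfl
  change (INet.precomp _ (maskOut t) (fun k => k.elim 0 c) (estrin F t)).realize _ (fun s => relu (affine (fun s =>
    Sum.elim (fun _ : Fin (d + 1) => B) (fun s' : Bool => if s = s' then 1 else 0))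
      (fun _ => -(B * (d + 1)))
      (fun i => Sum.elim (fun _ => bisu) (fun _ => relu) i
        (affine (Sum.elim Λ (fun s j => boolSign s * a j) : Fin (d + 1) ⊕ Bool → _)
          (Sum.elim τ (fun s => boolSign s * β)) x i)) s)) () = _
  rw [INet.realize_precomp, realize_estrin]
  simp only [h2]
  refine Finset.sum_congr rfl fun j _ => ?_
  by_cases hall : ∀ i, 0 < affine Λ τ x i
  · simp only [if_pos hall]
    simp only [affine, maskOut, Option.elim, zero_mul, Finset.sum_const_zero, zero_add, add_zero]
    rw [Fintype.sum_bool]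
    congr 2
    simpa [boolSign, sub_eq_add_neg] using relu_sub_relu_neg y
  · simp only [if_neg hall]
    simp [affine, maskOut]

theorem size_maskedPoly_le {r : ℕ} (F : QuadNeurons r) {d t : ℕ} (Λ : Fin (d + 1) → Fin d → ℝ)
    (τ : Fin (d + 1) → ℝ) (a : Fin d → ℝ) (β B : ℝ) (c : Fin (2 ^ t) → ℝ) :
    (maskedPoly F Λ τ a β B c).size _ ≤ (d + 3) * (d + 1) + 2 * (d + 4) +
      (20 * Fintype.card F.ι + (4 * Fintype.card F.ι * (6 * Fintype.card F.ι + 1) +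
      24 * Fintype.card F.ι + 1)) * 2 ^ t := by
  set Φ := maskedPoly F Λ τ a β B c with hΦ
  have hc : Fintype.card (Fin (d + 1) ⊕ Bool) = d + 3 := by simp
  have h1 : nnz Φ.1 ≤ (d + 3) * d := by
    refine (nnz_le_card_mul _).trans (le_of_eq ?_)
    rw [Fintype.card_fin]
    exact congrArg (· * d) hc
  have h2 : vnz Φ.2.1 ≤ d + 3 := (vnz_le_card _).trans hc.le
  have h3 : nnz Φ.2.2.1 ≤ 2 * (d + 3) := by
    refine (nnz_le_card_mul _).trans (le_of_eq ?_)
    exact congrArg (2 * ·) hc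
  have h4 : vnz Φ.2.2.2.1 ≤ 2 := vnz_le_card _
  have h5 : INet.size (estrinLayers F t) Φ.2.2.2.2 ≤
      4 * 2 ^ t * Fintype.card F.ι * (2 * 2 + 1) + (estrin F t).size _ :=
    INet.size_precomp_le (α := Bool) _ _ _ _ _ (fun k => vnz_le_card _)
      (estrin_firstLayerSparse F t)
  have h6 := size_estrin_le F t
  have h7 : Φ.size _ = nnz Φ.1 + vnz Φ.2.1 + (nnz Φ.2.2.1 + vnz Φ.2.2.2.1 +
    INet.size (estrinLayers F t) Φ.2.2.2.2) := rfl
  rw [h7]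
  nlinarith

/-! ### Polynomials as sums of ridge functions -/

open MvPolynomial in
/-- Every monomial of degree `k` is a linear combination of `k`-th powers of linear forms. -/
theorem monomial_mem_span_linear_pow {d k : ℕ} (α : Fin d →₀ ℕ) (hα : α.degree = k) :
    monomial α (1 : ℝ) ∈ Submodule.span ℝ
      (Set.range fun a : Fin d → ℝ => (∑ i, a i • X i : MvPolynomial (Fin d) ℝ) ^ k) := by
  classical
  by_contra hcon
  obtain ⟨φ, hφ, hker⟩ := Submodule.exists_le_ker_of_notMem hcon
  refine hφ ?_
  have hz : ∀ a : Fin d → ℝ, φ ((∑ i, a i • X i : MvPolynomial (Fin d) ℝ) ^ k) = 0 :=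
    fun a => hker (Submodule.subset_span ⟨a, rfl⟩)
  set S : Finset (Fin d →₀ ℕ) := Finset.finsuppAntidiag Finset.univ k with hS
  have hmem : ∀ s : Fin d →₀ ℕ, s ∈ S ↔ s.sum (fun _ m => m) = k := by
    intro s
    simp [hS, Finset.mem_finsuppAntidiag, Finsupp.sum_fintype]
  have hexp : ∀ a : Fin d → ℝ, (∑ i, a i • X i : MvPolynomial (Fin d) ℝ) ^ k =
      ∑ s ∈ S, ((s.multinomial : ℝ) * s.prod fun i m => a i ^ m) • monomial s (1 : ℝ) := by
    intro a
    ext s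
    rw [coeff_linearCombination_X_pow_of_fintype, coeff_sum]
    simp only [coeff_smul, coeff_monomial, smul_eq_mul, mul_ite, mul_one, mul_zero,
      Finset.sum_ite_eq', hmem]
  -- `f` is the polynomial function `a ↦ φ ((∑ a i X i)^k)` of the direction. It vanishes
  -- everywhere, hence identically, and its coefficients are nonzero multiples of the values of `φ`
  -- at monomials.
  set f : MvPolynomial (Fin d) ℝ :=
    ∑ s ∈ S, monomial s ((s.multinomial : ℝ) * φ (monomial s 1)) with hf
  have hf0 : f = 0 := by
    refine MvPolynomial.funext fun a => ?_
    rw [map_zero, ← hz a, hexp, map_sum, map_sum]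
    refine Finset.sum_congr rfl fun s _ => ?_
    rw [eval_monomial, map_smul, smul_eq_mul]
    ring
  have hco : coeff α f = 0 := by rw [hf0, coeff_zero]
  have hαS : α ∈ S := by
    rw [hmem, ← hα]
    rfl
  rw [hf, coeff_sum] at hco
  simp only [coeff_monomial, Finset.sum_ite_eq', hαS, if_true] at hco
  refine (mul_eq_zero.1 hco).resolve_left ?_
  have : 0 < α.multinomial := Nat.multinomial_pos _ _
  exact_mod_cast this.ne'

open MvPolynomial in
theorem pderiv_linear_pow {d : ℕ} (i₀ : Fin d) (a : Fin d → ℝ) (j : ℕ) :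
    pderiv i₀ ((∑ i, a i • X i : MvPolynomial (Fin d) ℝ) ^ (j + 1)) =
      ((j + 1 : ℝ) * a i₀) • (∑ i, a i • X i : MvPolynomial (Fin d) ℝ) ^ j := by
  have h : pderiv i₀ (∑ i, a i • X i : MvPolynomial (Fin d) ℝ) = C (a i₀) := by
    simp only [map_sum, Derivation.map_smul, pderiv_X, Pi.single_apply, smul_ite, smul_zero,
      Finset.sum_ite_eq', Finset.mem_univ, if_true]
    rw [smul_eq_C_mul, mul_one]
  rw [Derivation.leibniz_pow, h, Nat.add_sub_cancel, smul_eq_mul, nsmul_eq_mul, smul_eq_C_mul,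
    C_mul]
  push_cast
  simp only [map_add, map_natCast, map_one]
  ring

open MvPolynomial in
/-- There are `#{α : |α| = k}` directions such that, for all `j ≤ k`, the `j`-th powers of the
corresponding linear forms span the monomials of degree `j`. -/
theorem exists_directions {d : ℕ} (i₀ : Fin d) (k : ℕ) :
    ∃ a : Fin (Finset.finsuppAntidiag (Finset.univ : Finset (Fin d)) k).card → Fin d → ℝ,
      ∀ j ≤ k, ∀ α : Fin d →₀ ℕ, α.degree = j → monomial α (1 : ℝ) ∈ Submodule.span ℝ
        (Set.range fun m => (∑ i, a m i • X i : MvPolynomial (Fin d) ℝ) ^ j) := by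
  classical
  set S := Finset.finsuppAntidiag (Finset.univ : Finset (Fin d)) k with hS
  set P : Set (MvPolynomial (Fin d) ℝ) :=
    Set.range fun a : Fin d → ℝ => (∑ i, a i • X i : MvPolynomial (Fin d) ℝ) ^ k with hP
  have hle : Submodule.span ℝ P ≤
      Submodule.span ℝ (S.image fun s => monomial s (1 : ℝ) : Set (MvPolynomial (Fin d) ℝ)) := by
    rw [Submodule.span_le]
    rintro _ ⟨a, rfl⟩
    change (∑ i, a i • X i : MvPolynomial (Fin d) ℝ) ^ k ∈ _
    rw [MvPolynomial.as_sum ((∑ i, a i • X i : MvPolynomial (Fin d) ℝ) ^ k)]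
    refine Submodule.sum_mem _ fun s hs => ?_
    rw [mem_support_iff, coeff_linearCombination_X_pow_of_fintype] at hs
    have hsk : s ∈ S := by
      rw [hS, Finset.mem_finsuppAntidiag]
      refine ⟨?_, Finset.subset_univ _⟩
      have := (ite_ne_right_iff.1 hs).1
      rwa [Finsupp.sum_fintype _ _ fun _ => rfl] at this
    have : monomial s (coeff s ((∑ i, a i • X i : MvPolynomial (Fin d) ℝ) ^ k)) =
        (coeff s ((∑ i, a i • X i : MvPolynomial (Fin d) ℝ) ^ k)) • monomial s (1 : ℝ) := by
      rw [smul_monomial, smul_eq_mul, mul_one]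
    rw [this]
    exact Submodule.smul_mem _ _ (Submodule.subset_span
      (Finset.mem_coe.2 (Finset.mem_image_of_mem _ hsk)))
  have hfin : Module.Finite ℝ (Submodule.span ℝ P) := Submodule.finiteDimensional_of_le hle
  have hrank : Module.finrank ℝ (Submodule.span ℝ P) ≤ S.card :=
    (Submodule.finrank_mono hle).trans
      ((finrank_span_finset_le_card _).trans Finset.card_image_le)
  obtain ⟨f, hfP, hf, -⟩ := Submodule.exists_fun_fin_finrank_span_eq ℝ P
  choose b hb using hfP
  -- Padding with zero directions makes the number of directions an explicit function of `d` and
  -- `k`.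
  refine ⟨fun m => if h : (m : ℕ) < Module.finrank ℝ (Submodule.span ℝ P) then b ⟨m, h⟩ else 0, ?_⟩
  intro j hj
  induction hj using Nat.decreasingInduction with
  | self =>
    intro α hα
    have h1 := monomial_mem_span_linear_pow α hα
    rw [← hP, ← hf] at h1
    refine Submodule.span_mono ?_ h1
    rintro _ ⟨m, rfl⟩
    refine ⟨⟨m, m.2.trans_le hrank⟩, ?_⟩
    simp only [m.2, dif_pos, hb]
  -- Differentiating in the variable `i₀` maps powers of order `j + 1` to multiples of powers of
  -- order `j` of the same forms, and `X^(α + e)` with `e` the unit multi-index at `i₀` to a nonzero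
  -- multiple of `X^α`. So the directions found for `k` serve all lower degrees.
  | of_succ j hj ih =>
    intro α hα
    have h1 := ih (α + Finsupp.single i₀ 1) (by rw [map_add, hα, Finsupp.degree_single])
    have h2 := Submodule.mem_map_of_mem (f := (pderiv i₀).toLinearMap) h1
    rw [Submodule.map_span] at h2
    have h3 : (pderiv (R := ℝ) i₀).toLinearMap (monomial (α + Finsupp.single i₀ 1) (1 : ℝ)) =
        (α i₀ + 1 : ℝ) • monomial α (1 : ℝ) := by
      change pderiv i₀ _ = _
      rw [pderiv_monomial, smul_monomial]
      simp
    rw [h3] at h2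
    have h4 : (α i₀ + 1 : ℝ) ≠ 0 := by positivity
    refine (Submodule.smul_mem_iff _ h4).1 (Submodule.span_le.2 ?_ h2)
    rintro _ ⟨_, ⟨m, rfl⟩, rfl⟩
    change pderiv i₀ _ ∈ _
    rw [pderiv_linear_pow]
    exact Submodule.smul_mem _ _ (Submodule.subset_span ⟨m, rfl⟩)

open MvPolynomial in
/-- A polynomial of degree at most `k` is a sum of univariate polynomials without constant term of
affine functions. -/
theorem exists_ridge {d : ℕ} (i₀ : Fin d) {k t : ℕ} (hk : 1 ≤ k) (ht : k < 2 ^ t)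
    (p : MvPolynomial (Fin d) ℝ) (hp : p.totalDegree ≤ k) :
    ∃ (a : Option (Fin (Finset.finsuppAntidiag (Finset.univ : Finset (Fin d)) k).card) → Fin d → ℝ)
      (β : Option (Fin (Finset.finsuppAntidiag (Finset.univ : Finset (Fin d)) k).card) → ℝ)
      (c : Option (Fin (Finset.finsuppAntidiag (Finset.univ : Finset (Fin d)) k).card) →
        Fin (2 ^ t) → ℝ),
      (∀ m (j : Fin (2 ^ t)), (j : ℕ) = 0 → c m j = 0) ∧
      ∀ x, eval x p = ∑ m, ∑ j, c m j * (∑ i, a m i * x i + β m) ^ (j : ℕ) := by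
  obtain ⟨a, ha⟩ := exists_directions i₀ k
  set A : Option (Fin (Finset.finsuppAntidiag (Finset.univ : Finset (Fin d)) k).card) →
    Fin d → ℝ := fun m => m.elim 0 a
  set β : Option (Fin (Finset.finsuppAntidiag (Finset.univ : Finset (Fin d)) k).card) → ℝ :=
    fun m => m.elim 1 fun _ => 0
  set P : Option (Fin (Finset.finsuppAntidiag (Finset.univ : Finset (Fin d)) k).card) ×
      Fin (2 ^ t) → MvPolynomial (Fin d) ℝ :=
    fun q => if (q.2 : ℕ) = 0 then 0 else (∑ i, A q.1 i • X i + C (β q.1)) ^ (q.2 : ℕ) with hP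
  have hmem : p ∈ Submodule.span ℝ (Set.range P) := by
    rw [MvPolynomial.as_sum p]
    refine Submodule.sum_mem _ fun s hs => ?_
    have hsk : s.degree ≤ k := (le_totalDegree hs).trans hp
    have : monomial s (coeff s p) = coeff s p • monomial s (1 : ℝ) := by
      rw [smul_monomial, smul_eq_mul, mul_one]
    rw [this]
    refine Submodule.smul_mem _ _ ?_
    by_cases h0 : s.degree = 0
    · have hs0 : s = 0 := (Finsupp.degree_eq_zero_iff s).1 h0
      -- The constant term is the first power of the constant affine form `1`, so that exponent `0`
      -- is never used.
      refine Submodule.subset_span ⟨(none, ⟨1, by omega⟩), ?_⟩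
      simp [hP, A, β, hs0]
    · refine Submodule.span_mono ?_ (ha _ hsk s rfl)
      rintro _ ⟨m, rfl⟩
      refine ⟨(some m, ⟨s.degree, hsk.trans_lt ht⟩), ?_⟩
      simp [hP, A, β, h0]
  obtain ⟨c, hc⟩ := (Submodule.mem_span_range_iff_exists_fun ℝ).1 hmem
  refine ⟨A, β, fun m j => if (j : ℕ) = 0 then 0 else c (m, j), fun m j hj => if_pos hj,
    fun x => ?_⟩
  rw [← hc, map_sum, Fintype.sum_prod_type]
  refine Finset.sum_congr rfl fun m _ => Finset.sum_congr rfl fun j _ => ?_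
  by_cases hj : (j : ℕ) = 0
  · simp only [hP, if_pos hj, smul_zero, map_zero, zero_mul]
  · simp only [hP, if_neg hj, smul_eval, map_pow, map_add, map_sum, eval_X, eval_C]

/-- The count is the binomial coefficient `(e + k).choose e`. Raising `e` by one multiplies it by
`(e + 1 + k) / (e + 1)`, and the induction closes because `2 (e + 1 + k) ≤ (e + 2) (k + 1)`, that
is, `e ≤ e k`. -/
theorem card_finsuppAntidiag_mul_le (e : ℕ) {k : ℕ} (hk : 1 ≤ k) :
    (Finset.finsuppAntidiag (Finset.univ : Finset (Fin (e + 1))) k).card * 2 ^ e ≤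
      (e + 1) * (k + 1) ^ e := by
  rw [Finset.card_finsuppAntidiag_nat_eq_choose, Finset.card_univ, Fintype.card_fin,
    show e + 1 + k - 1 = e + k by omega, ← Nat.choose_symm_add]
  induction e with
  | zero => simp
  | succ e ih =>
    have h := Nat.add_one_mul_choose_eq (e + k) e
    rw [show e + k + 1 = e + 1 + k by omega] at h
    refine Nat.le_of_mul_le_mul_left ?_ (Nat.succ_pos e)
    calc (e + 1) * ((e + 1 + k).choose (e + 1) * 2 ^ (e + 1))
        = (2 * (e + 1 + k)) * ((e + k).choose e * 2 ^ e) := by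
          rw [pow_succ]
          have : (e + 1) * (e + 1 + k).choose (e + 1) = (e + 1 + k) * (e + k).choose e := by
            rw [h, mul_comm]
          rw [← mul_assoc, this]
          ring
      _ ≤ (2 * (e + 1 + k)) * ((e + 1) * (k + 1) ^ e) := Nat.mul_le_mul_left _ ih
      _ ≤ ((e + 2) * (k + 1)) * ((e + 1) * (k + 1) ^ e) :=
          Nat.mul_le_mul_right _ (by nlinarith [Nat.mul_le_mul_left e hk])
      _ = (e + 1) * ((e + 1 + 1) * (k + 1) ^ (e + 1)) := by ring

/-! ### Simplices and meshes -/

/-- The vertices of a nondegenerate `d`-simplex as an affine basis. -/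
def simplexBasis {d : ℕ} {V : Finset (Fin d → ℝ)} (hV : V.card = d + 1)
    (hind : AffineIndependent ℝ (fun a : V => (a : Fin d → ℝ))) :
    AffineBasis V ℝ (Fin d → ℝ) where
  toFun a := a
  ind' := hind
  tot' := by
    rw [hind.affineSpan_eq_top_iff_card_eq_finrank_add_one]
    simp [hV]

theorem mem_openHull_iff {d : ℕ} {V : Finset (Fin d → ℝ)} (hV : V.card = d + 1)
    (hind : AffineIndependent ℝ (fun a : V => (a : Fin d → ℝ))) (x : Fin d → ℝ) :
    x ∈ openHull V ↔ ∀ a, 0 < (simplexBasis hV hind).coord a x := by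
  classical
  constructor
  · rintro ⟨w, hw, hw1, rfl⟩ a
    have h1 : ∑ a : V, w a = 1 := by rw [← hw1, ← Finset.sum_coe_sort V]
    have h2 : ∑ a ∈ V, w a • a =
        Finset.univ.affineCombination ℝ (simplexBasis hV hind) (fun a : V => w a) := by
      rw [Finset.affineCombination_eq_linear_combination _ _ _ h1, ← Finset.sum_coe_sort V]
      rfl
    rw [h2, AffineBasis.coord_apply_combination_of_mem _ (Finset.mem_univ a) h1]
    exact hw a a.2
  · intro h
    refine ⟨fun a => if ha : a ∈ V then (simplexBasis hV hind).coord ⟨a, ha⟩ x else 0,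
      fun a ha => by simp only [ha, dif_pos]; exact h _, ?_, ?_⟩
    · rw [← Finset.sum_coe_sort V]
      simpa using (simplexBasis hV hind).sum_coord_apply_eq_one x
    · rw [← Finset.sum_coe_sort V]
      have hcoe : ∀ a : V, simplexBasis hV hind a = (a : Fin d → ℝ) := fun _ => rfl
      simpa [hcoe] using ((simplexBasis hV hind).linear_combination_coord_eq_self x).symm

theorem exists_affine_eq {d : ℕ} (f : (Fin d → ℝ) →ᵃ[ℝ] ℝ) :
    ∃ (a : Fin d → ℝ) (b : ℝ), ∀ x, f x = ∑ j, a j * x j + b := by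
  refine ⟨fun j => f.linear (Pi.single j 1), f 0, fun x => ?_⟩
  have h := congrFun (AffineMap.decomp f) x
  rw [h, Pi.add_apply]
  congr 1
  conv_lhs => rw [← Finset.univ_sum_single x]
  rw [map_sum]
  refine Finset.sum_congr rfl fun j _ => ?_
  rw [show (Pi.single j (x j) : Fin d → ℝ) = x j • Pi.single j 1 by
    rw [← Pi.single_smul, smul_eq_mul, mul_one], map_smul, smul_eq_mul, mul_comm]

/-- A nondegenerate open `d`-simplex is given by `d + 1` strict affine inequalities. -/
theorem exists_inequalities {d : ℕ} {V : Finset (Fin d → ℝ)} (hV : V.card = d + 1)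
    (hind : AffineIndependent ℝ (fun a : V => (a : Fin d → ℝ))) :
    ∃ (Λ : Fin (d + 1) → Fin d → ℝ) (τ : Fin (d + 1) → ℝ),
      ∀ x, x ∈ openHull V ↔ ∀ i, 0 < affine Λ τ x i := by
  choose a b hab using fun v : V => exists_affine_eq ((simplexBasis hV hind).coord v)
  set e := V.equivFinOfCardEq hV
  refine ⟨fun i => a (e.symm i), fun i => b (e.symm i), fun x => ?_⟩
  rw [mem_openHull_iff hV hind, ← e.symm.forall_congr_right]
  simp only [hab, affine]

theorem openHull_eq_interior {d : ℕ} {V : Finset (Fin d → ℝ)} (hV : V.card = d + 1)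
    (hind : AffineIndependent ℝ (fun a : V => (a : Fin d → ℝ))) :
    openHull V = interior (convexHull ℝ (V : Set (Fin d → ℝ))) := by
  have h := (simplexBasis hV hind).interior_convexHull
  have hr : Set.range (simplexBasis hV hind) = (V : Set (Fin d → ℝ)) := by
    change Set.range (fun a : V => (a : Fin d → ℝ)) = _
    simp
  rw [hr] at h
  rw [h]
  ext x
  exact mem_openHull_iff hV hind x

theorem IsRegularMesh.isOpen_openHull {d : ℕ} {Ω : Set (Fin d → ℝ)}
    {𝒯 : Finset (Finset (Fin d → ℝ))} (h𝒯 : IsRegularMesh Ω 𝒯) {V : Finset (Fin d → ℝ)}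
    (hV : V ∈ 𝒯) : IsOpen (openHull V) := by
  rw [openHull_eq_interior (h𝒯.card_eq V hV) (h𝒯.affineIndependent V hV)]
  exact isOpen_interior

theorem IsRegularMesh.ae_mem {d : ℕ} {Ω : Set (Fin d → ℝ)} {𝒯 : Finset (Finset (Fin d → ℝ))}
    (h𝒯 : IsRegularMesh Ω 𝒯) (hΩ : IsOpen Ω) :
    ∀ᵐ x ∂(volume.restrict Ω), x ∈ Ω ∧ ∃ V ∈ 𝒯, x ∈ openHull V := by
  have h1 : ∀ᵐ x ∂(volume.restrict Ω), ∀ V ∈ 𝒯, x ∉ frontier (openHull V) := by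
    rw [Finset.eventually_all]
    intro V hV
    refine ae_restrict_of_ae (measure_eq_zero_iff_ae_notMem.1 ?_)
    rw [openHull_eq_interior (h𝒯.card_eq V hV) (h𝒯.affineIndependent V hV)]
    -- The boundary of a convex set is a null set, so almost every point of the domain lies in an
    -- open element.
    exact (convex_convexHull ℝ _).interior.addHaar_frontier volume
  filter_upwards [h1, ae_restrict_mem hΩ.measurableSet] with x hx hxΩ
  refine ⟨hxΩ, ?_⟩
  have hcl : x ∈ ⋃ V ∈ 𝒯, closure (openHull V) := h𝒯.closure_eq ▸ subset_closure hxΩ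
  simp only [Set.mem_iUnion] at hcl
  obtain ⟨V, hV, hxV⟩ := hcl
  refine ⟨V, hV, ?_⟩
  rw [closure_eq_self_union_frontier] at hxV
  exact hxV.resolve_right (hx V hV)

/-! ### Finite element functions are piecewise polynomial -/

/-- `v` agrees with vector fields of polynomials of degree at most `k` on the elements. -/
def IsPiecewise {d μ : ℕ} {Ω : Set (Fin d → ℝ)} (𝒯 : Finset (Finset (Fin d → ℝ))) (k : ℕ)
    (v : AEFun Ω μ) : Prop :=
  ∀ V ∈ 𝒯, ∃ w : Fin μ → MvPolynomial (Fin d) ℝ,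
    (∀ j, w j ∈ MvPolynomial.restrictTotalDegree (Fin d) ℝ k) ∧
      ∀ᵐ x ∂(volume.restrict Ω), x ∈ openHull V → ∀ j, v x j = MvPolynomial.eval x (w j)

theorem IsRTPoly.totalDegree_le {d k : ℕ} {w : Fin d → MvPolynomial (Fin d) ℝ}
    (hw : IsRTPoly k w) (j : Fin d) : (w j).totalDegree ≤ k + 1 := by
  obtain ⟨q, h, hh, hq, he⟩ := hw
  rw [he]
  refine (MvPolynomial.totalDegree_add _ _).trans (max_le ?_ ?_)
  · exact ((MvPolynomial.mem_restrictTotalDegree _ _ _).1 (hq j)).trans (Nat.le_succ k)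
  · refine (MvPolynomial.totalDegree_mul _ _).trans ?_
    rw [MvPolynomial.totalDegree_X, add_comm]
    exact Nat.add_le_add_right
      ((MvPolynomial.mem_homogeneousSubmodule _ _).1 hh).totalDegree_le 1

theorem isPiecewise_of_scalar {d k : ℕ} {Ω : Set (Fin d → ℝ)} {𝒯 : Finset (Finset (Fin d → ℝ))}
    {v : AEFun Ω 1} (hv : IsPiecewisePoly Ω 𝒯 k (fun x => v x 0)) : IsPiecewise 𝒯 k v := by
  intro V hV
  obtain ⟨p, hp, hx⟩ := hv V hV
  refine ⟨fun _ => p, fun _ => hp, ?_⟩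
  filter_upwards [hx] with x hx hxV j
  rw [Subsingleton.elim j 0, hx hxV]

theorem FEKind.isPiecewise {d k : ℕ} (hk : 1 ≤ k) {Ω : Set (Fin d → ℝ)}
    {𝒯 : Finset (Finset (Fin d → ℝ))} (K : FEKind) {v : AEFun Ω (K.valueDim d)}
    (hv : v ∈ K.space k Ω 𝒯) : IsPiecewise 𝒯 k v := by
  cases K with
  | lagrange => exact isPiecewise_of_scalar hv.2
  | discontinuous => exact isPiecewise_of_scalar hv.2
  | raviartThomas =>
    obtain ⟨-, u, hu, h1, -⟩ := hv
    intro V hV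
    obtain ⟨w, hw, hx⟩ := h1 V hV
    refine ⟨w, fun j => (MvPolynomial.mem_restrictTotalDegree _ _ _).2 ?_, ?_⟩
    -- Order `k - 1` gives degree `k - 1 + 1 = k`, as `1 ≤ k` excludes truncated subtraction.
    · exact (hw.totalDegree_le j).trans (by omega)
    · filter_upwards [hu] with x hux hxV j
      exact (congrFun hux j).trans (hx x hxV j)

open Classical in
/-- Piecewise polynomial functions as functions on the whole space. -/
def piecewiseFun {d μ k : ℕ} (𝒯 : Finset (Finset (Fin d → ℝ)))
    (w : 𝒯 → Fin μ → MvPolynomial.restrictTotalDegree (Fin d) ℝ k) (x : Fin d → ℝ) (j : Fin μ) :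
    ℝ :=
  ∑ V : 𝒯, if x ∈ openHull (V : Finset (Fin d → ℝ)) then
    MvPolynomial.eval x (w V j : MvPolynomial (Fin d) ℝ) else 0

theorem IsRegularMesh.measurable_piecewiseFun {d μ k : ℕ} {Ω : Set (Fin d → ℝ)}
    {𝒯 : Finset (Finset (Fin d → ℝ))} (h𝒯 : IsRegularMesh Ω 𝒯)
    (w : 𝒯 → Fin μ → MvPolynomial.restrictTotalDegree (Fin d) ℝ k) :
    Measurable (piecewiseFun 𝒯 w) := by
  classical
  refine measurable_pi_lambda _ fun j => Finset.measurable_sum _ fun V _ => ?_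
  exact Measurable.ite (h𝒯.isOpen_openHull V.2).measurableSet
    (MvPolynomial.continuous_eval _).measurable measurable_const

/-- The linear map which glues polynomials on the elements of a mesh. -/
def IsRegularMesh.glue {d : ℕ} {Ω : Set (Fin d → ℝ)} {𝒯 : Finset (Finset (Fin d → ℝ))}
    (h𝒯 : IsRegularMesh Ω 𝒯) (μ k : ℕ) :
    (𝒯 → Fin μ → MvPolynomial.restrictTotalDegree (Fin d) ℝ k) →ₗ[ℝ] AEFun Ω μ where
  toFun w := AEEqFun.mk (piecewiseFun 𝒯 w)
    (h𝒯.measurable_piecewiseFun w).stronglyMeasurable.aestronglyMeasurable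
  map_add' w w' := by
    rw [AEEqFun.mk_add_mk, AEEqFun.mk_eq_mk]
    refine Eventually.of_forall fun x => funext fun j => ?_
    simp only [piecewiseFun, Pi.add_apply, ← Finset.sum_add_distrib]
    refine Finset.sum_congr rfl fun V _ => ?_
    split_ifs <;> simp
  map_smul' c w := by
    rw [RingHom.id_apply, AEEqFun.smul_mk, AEEqFun.mk_eq_mk]
    refine Eventually.of_forall fun x => funext fun j => ?_
    simp only [piecewiseFun, Pi.smul_apply, smul_eq_mul, Finset.mul_sum]
    refine Finset.sum_congr rfl fun V _ => ?_
    split_ifs <;> simp [MvPolynomial.smul_eval]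

theorem IsRegularMesh.sum_ite_mem {d : ℕ} {Ω : Set (Fin d → ℝ)}
    {𝒯 : Finset (Finset (Fin d → ℝ))} (h𝒯 : IsRegularMesh Ω 𝒯) {ι : Type} [Fintype ι]
    (E : ι → Finset (Fin d → ℝ)) (hE : Function.Injective E) (hE' : ∀ i, E i ∈ 𝒯)
    [∀ (x : Fin d → ℝ) i, Decidable (x ∈ openHull (E i))] (i : ι) {x : Fin d → ℝ}
    (hx : x ∈ openHull (E i)) (f : ι → ℝ) :
    ∑ i', (if x ∈ openHull (E i') then f i' else 0) = f i := by
  rw [Fintype.sum_eq_single i, if_pos hx]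
  intro i' hi'
  refine if_neg fun hx' => ?_
  exact Set.disjoint_left.1 (h𝒯.disjoint _ (hE' i') _ (hE' i) (hE.ne hi')) hx' hx

/-- This places each finite element space inside the image of a finite-dimensional space of
polynomial tuples. -/
theorem IsRegularMesh.mem_range_glue {d μ k : ℕ} {Ω : Set (Fin d → ℝ)}
    {𝒯 : Finset (Finset (Fin d → ℝ))} (h𝒯 : IsRegularMesh Ω 𝒯) (hΩ : IsOpen Ω) {v : AEFun Ω μ}
    (hv : IsPiecewise 𝒯 k v) : v ∈ LinearMap.range (h𝒯.glue μ k) := by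
  classical
  choose w hw hx using fun V : 𝒯 => hv V V.2
  refine ⟨fun V j => ⟨w V j, hw V j⟩, ?_⟩
  have h1 : ∀ᵐ x ∂(volume.restrict Ω), ∀ V : 𝒯, x ∈ openHull (V : Finset (Fin d → ℝ)) →
      ∀ j, v x j = MvPolynomial.eval x (w V j) := eventually_all.2 hx
  refine AEEqFun.ext ((AEEqFun.coeFn_mk _ _).trans ?_)
  filter_upwards [h1, h𝒯.ae_mem hΩ] with x hx ⟨_, V, hV, hxV⟩
  funext j
  rw [hx ⟨V, hV⟩ hxV]
  exact h𝒯.sum_ite_mem (fun V : 𝒯 => (V : Finset (Fin d → ℝ))) Subtype.val_injective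
    (fun V => V.2) ⟨V, hV⟩ hxV _

theorem FEKind.finiteDimensional_space {d k : ℕ} (hk : 1 ≤ k) {Ω : Set (Fin d → ℝ)}
    (hΩ : IsOpen Ω) {𝒯 : Finset (Finset (Fin d → ℝ))} (h𝒯 : IsRegularMesh Ω 𝒯) (K : FEKind) :
    FiniteDimensional ℝ (K.space k Ω 𝒯) :=
  Submodule.finiteDimensional_of_le (S₂ := LinearMap.range (h𝒯.glue (K.valueDim d) k))
    fun _ hv => h𝒯.mem_range_glue hΩ (K.isPiecewise hk hv)

/-- A piecewise polynomial function supported on `s` elements is a sum of `s` polynomials, each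
restricted to a set given by affine inequalities. -/
theorem IsRegularMesh.exists_local_sum {d μ k s : ℕ} {Ω : Set (Fin d → ℝ)}
    {𝒯 : Finset (Finset (Fin d → ℝ))} (h𝒯 : IsRegularMesh Ω 𝒯) (hΩ : IsOpen Ω) {v : AEFun Ω μ}
    (hv : IsPiecewise 𝒯 k v) (hs : SupportedOn 𝒯 v s) :
    ∃ (Λ : Fin s → Fin (d + 1) → Fin d → ℝ) (τ : Fin s → Fin (d + 1) → ℝ)
      (w : Fin s → Fin μ → MvPolynomial (Fin d) ℝ), (∀ t j, (w t j).totalDegree ≤ k) ∧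
      ∀ᵐ x ∂(volume.restrict Ω), ∀ j, v x j =
        ∑ t, if ∀ i, 0 < affine (Λ t) (τ t) x i then MvPolynomial.eval x (w t j) else 0 := by
  classical
  obtain ⟨𝒮, h𝒮, hcard, hzero⟩ := hs
  set e := 𝒮.equivFinOfCardEq hcard
  have hmem : ∀ t, (e.symm t : Finset (Fin d → ℝ)) ∈ 𝒯 := fun t => h𝒮 (e.symm t).2
  choose Λ τ hΛ using fun t : Fin s =>
    exists_inequalities (h𝒯.card_eq _ (hmem t)) (h𝒯.affineIndependent _ (hmem t))
  choose w hw hx using fun t => hv _ (hmem t)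
  refine ⟨Λ, τ, w, fun t j => (MvPolynomial.mem_restrictTotalDegree _ _ _).1 (hw t j), ?_⟩
  have h0 : ∀ᵐ x ∂(volume.restrict Ω), ∀ V ∈ 𝒯, V ∉ 𝒮 → x ∈ openHull V → v x = 0 := by
    rw [Finset.eventually_all]
    intro V hV
    by_cases h : V ∈ 𝒮
    · exact Eventually.of_forall fun x h' => (h' h).elim
    · filter_upwards [hzero V hV h] with x hx _
      exact hx
  filter_upwards [eventually_all.2 hx, h0, h𝒯.ae_mem hΩ] with x hx hx0 ⟨_, V, hV, hxV⟩ j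
  simp only [← hΛ]
  by_cases h : V ∈ 𝒮
  · have hV' : x ∈ openHull (e.symm (e ⟨V, h⟩) : Finset (Fin d → ℝ)) := by simpa using hxV
    rw [hx _ hV']
    exact (h𝒯.sum_ite_mem (fun t => (e.symm t : Finset (Fin d → ℝ)))
      (Subtype.val_injective.comp e.symm.injective) hmem (e ⟨V, h⟩) hV' fun t =>
        MvPolynomial.eval x (w t j)).symm
  -- Off the support both sides vanish: the elements are disjoint, so no indicator of an element of
  -- `𝒮` is active at `x`.
  · rw [hx0 V hV h hxV]
    refine (Finset.sum_eq_zero fun t _ => if_neg fun hxt => ?_).symm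
    refine Set.disjoint_left.1 (h𝒯.disjoint _ (hmem t) _ hV fun heq => h ?_) hxt hxV
    exact heq ▸ (e.symm t).2

/-! ### Emulation of finite element functions -/

/-- The number of directions used for polynomials of degree `k` in `d` variables, that is, the
number of monomials of degree `k`. -/
def numDirections (d k : ℕ) : ℕ := (Finset.finsuppAntidiag (Finset.univ : Finset (Fin d)) k).card

/-- The hidden layers of the networks `maskedPoly` for polynomials of degree at most `k`. -/
def unitLayers {r : ℕ} (F : QuadNeurons r) (d k : ℕ) : List Layer :=
  testLayer d :: maskLayer :: estrinLayers F (Nat.clog 2 (k + 1))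

/-- Supplies the bias `B` needed by `relu_mask`; it affects weights but not the size bound. -/
theorem exists_abs_affine_le {d : ℕ} {Ω : Set (Fin d → ℝ)} (hΩ : Bornology.IsBounded Ω)
    (a : Fin d → ℝ) (β : ℝ) : ∃ B, ∀ x ∈ Ω, |∑ j, a j * x j + β| ≤ B := by
  obtain ⟨R, hR⟩ := hΩ.exists_norm_le
  refine ⟨∑ j, |a j| * R + |β|, fun x hx => (abs_add_le _ _).trans ?_⟩
  gcongr
  refine (Finset.abs_sum_le_sum_abs _ _).trans (Finset.sum_le_sum fun j _ => ?_)
  rw [abs_mul]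
  gcongr
  exact (norm_le_pi_norm x j).trans (hR x hx)

/-- A polynomial restricted to a set given by `d + 1` affine inequalities is a sum of networks
`maskedPoly`. -/
theorem exists_localPoly {r : ℕ} (F : QuadNeurons r) {d k : ℕ} (i₀ : Fin d) (hk : 1 ≤ k)
    {Ω : Set (Fin d → ℝ)} (hΩ : Bornology.IsBounded Ω) (Λ : Fin (d + 1) → Fin d → ℝ)
    (τ : Fin (d + 1) → ℝ) (p : MvPolynomial (Fin d) ℝ) (hp : p.totalDegree ≤ k) :
    ∃ Φ : Option (Fin (numDirections d k)) → INet (unitLayers F d k) (Fin d) Unit,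
      (∀ m, (Φ m).size _ ≤ (d + 3) * (d + 1) + 2 * (d + 4) +
        (20 * Fintype.card F.ι + (4 * Fintype.card F.ι * (6 * Fintype.card F.ι + 1) +
        24 * Fintype.card F.ι + 1)) * 2 ^ Nat.clog 2 (k + 1)) ∧
      ∀ x ∈ Ω, ∑ m, (Φ m).realize _ x () =
        if ∀ i, 0 < affine Λ τ x i then MvPolynomial.eval x p else 0 := by
  obtain ⟨a, β, c, hc, hsum⟩ :=
    exists_ridge i₀ hk (Nat.lt_of_succ_le (Nat.le_pow_clog one_lt_two (k + 1))) p hp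
  choose B hB using fun m => exists_abs_affine_le hΩ (a m) (β m)
  refine ⟨fun m => maskedPoly F Λ τ (a m) (β m) (B m) (c m),
    fun m => size_maskedPoly_le F Λ τ (a m) (β m) (B m) (c m), fun x hx => ?_⟩
  have h1 : ∀ m, INet.realize (unitLayers F d k) (maskedPoly F Λ τ (a m) (β m) (B m) (c m)) x () =
      _ := fun m => realize_maskedPoly F Λ τ (a m) (β m) (B m) (c m) x (hB m x hx)
  refine (Finset.sum_congr rfl fun m _ => h1 m).trans ?_
  split_ifs with h
  · exact (hsum x).symm
  · refine Finset.sum_eq_zero fun m _ => Finset.sum_eq_zero fun j _ => ?_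
    by_cases hj : (j : ℕ) = 0
    · rw [hc m j hj, zero_mul]
    · rw [zero_pow hj, mul_zero]

/-- With `d = e + 1`, the left side times `2 ^ e` is at most `(e + 2) (k + 1)^e` times the cost of
one ridge network. The exponential `2 ^ e` dominates the cubic in `e` of the masking part, and the
evaluation part contributes the remaining factor `k + 1`. -/
theorem succ_numDirections_mul_le {d k : ℕ} (hd : 2 ≤ d) (hk : 1 ≤ k) (K : ℕ) :
    (numDirections d k + 1) *
      ((d + 3) * (d + 1) + 2 * (d + 4) + K * 2 ^ Nat.clog 2 (k + 1)) ≤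
      (41 + 4 * K) * (k + 1) ^ d := by
  obtain ⟨e, rfl⟩ : ∃ e, d = e + 1 := ⟨d - 1, by omega⟩
  have h1 := card_finsuppAntidiag_mul_le e hk
  rw [← numDirections] at h1
  have h2 : 2 ^ e ≤ (k + 1) ^ e := Nat.pow_le_pow_left (by omega) e
  -- The critical case is `e = 1`, where this reads `81 ≤ 82`.
  have h3 : (e + 2) * ((e + 1 + 3) * (e + 1 + 1) + 2 * (e + 1 + 4)) ≤ 41 * 2 ^ e := by
    have he : 1 ≤ e := by omega
    clear h1 h2 hd
    induction e, he using Nat.le_induction with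
    | base => norm_num
    | succ e he ih =>
      rw [pow_succ]
      nlinarith [Nat.mul_le_mul he he, Nat.mul_le_mul_right e (Nat.mul_le_mul he he)]
  have h4 : e + 2 ≤ 2 * 2 ^ e := by
    have := Nat.lt_two_pow_self (n := e)
    have := Nat.one_le_two_pow (n := e)
    omega
  have h5 : 2 ^ Nat.clog 2 (k + 1) ≤ 2 * (k + 1) := by
    have h6 := Nat.pow_pred_clog_lt_self one_lt_two (x := k + 1) (by omega)
    have h7 : 0 < Nat.clog 2 (k + 1) := Nat.clog_pos one_lt_two (by omega)
    obtain ⟨t, ht⟩ : ∃ t, Nat.clog 2 (k + 1) = t + 1 := ⟨Nat.clog 2 (k + 1) - 1, by omega⟩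
    rw [ht] at h6 ⊢
    rw [Nat.pred_succ] at h6
    rw [pow_succ]
    omega
  have h6 : (numDirections (e + 1) k + 1) * 2 ^ e ≤ (e + 2) * (k + 1) ^ e := by
    rw [add_mul, one_mul]
    calc _ ≤ (e + 1) * (k + 1) ^ e + (k + 1) ^ e := add_le_add h1 h2
      _ = _ := by ring
  refine Nat.le_of_mul_le_mul_left ?_ (pow_pos two_pos e : 0 < 2 ^ e)
  set f := (e + 1 + 3) * (e + 1 + 1) + 2 * (e + 1 + 4)
  set X := (k + 1) ^ e with hX
  have hX1 : X ≤ X * (k + 1) := Nat.le_mul_of_pos_right _ (Nat.succ_pos k)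
  calc 2 ^ e * ((numDirections (e + 1) k + 1) * (f + K * 2 ^ Nat.clog 2 (k + 1)))
      = ((numDirections (e + 1) k + 1) * 2 ^ e) * (f + K * 2 ^ Nat.clog 2 (k + 1)) := by ring
    _ ≤ ((e + 2) * X) * (f + K * (2 * (k + 1))) := by gcongr
    _ = X * ((e + 2) * f) + (e + 2) * (X * (K * (2 * (k + 1)))) := by ring
    _ ≤ X * (41 * 2 ^ e) + (2 * 2 ^ e) * (X * (K * (2 * (k + 1)))) := by gcongr
    _ ≤ (X * (k + 1)) * (41 * 2 ^ e) + (2 * 2 ^ e) * (X * (K * (2 * (k + 1)))) := by gcongr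
    _ = 2 ^ e * ((41 + 4 * K) * (k + 1) ^ (e + 1)) := by rw [pow_succ, ← hX]; ring

/-- The index set of the networks `maskedPoly` used for `n` functions with `μ` components, where
the `i`-th function is supported on `s i` elements. -/
abbrev UnitIndex (n : ℕ) (s : Fin n → ℕ) (μ M : ℕ) : Type :=
  (Σ i : Fin n, Fin (s i)) × Fin μ × Option (Fin M)

theorem sum_unitIndex {n μ M : ℕ} {s : Fin n → ℕ} (g : Fin n × Fin μ → ℝ)
    (f : UnitIndex n s μ M → ℝ) :
    ∑ q, g (q.1.1, q.2.1) * f q = ∑ q, g q * ∑ t, ∑ m, f (⟨q.1, t⟩, q.2, m) := by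
  rw [Fintype.sum_prod_type, Fintype.sum_sigma, Fintype.sum_prod_type]
  refine Finset.sum_congr rfl fun i _ => ?_
  have h : ∀ t : Fin (s i), ∑ y : Fin μ × Option (Fin M), g (i, y.1) * f (⟨i, t⟩, y) =
      ∑ j, ∑ m, g (i, j) * f (⟨i, t⟩, j, m) := fun t => Fintype.sum_prod_type _
  refine (Finset.sum_congr rfl fun t _ => h t).trans (Finset.sum_comm.trans ?_)
  simp only [Finset.mul_sum]

/-- The network which outputs linear combinations, with coefficients `g`, of the components of `n`
functions which are sums of the networks `Φ q`. -/
def combined {r : ℕ} (F : QuadNeurons r) {d k n μ : ℕ} {s : Fin n → ℕ} {β : Type}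
    (g : β → Fin n × Fin μ → ℝ)
    (Φ : UnitIndex n s μ (numDirections d k) → INet (unitLayers F d k) (Fin d) Unit) :
    INet ((unitLayers F d k).map (Layer.copies (UnitIndex n s μ (numDirections d k)))) (Fin d) β :=
  INet.parShared (fun i q => g i (q.1.1, q.2.1)) _ _ Φ

theorem realize_combined {r : ℕ} (F : QuadNeurons r) {d k n μ : ℕ} {s : Fin n → ℕ} {β : Type}
    (g : β → Fin n × Fin μ → ℝ)
    (Φ : UnitIndex n s μ (numDirections d k) → INet (unitLayers F d k) (Fin d) Unit)
    (x : Fin d → ℝ) (i : β) :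
    (combined F g Φ).realize _ x i =
      ∑ q, g i q * ∑ t, ∑ m, (Φ (⟨q.1, t⟩, q.2, m)).realize _ x () := by
  exact (INet.realize_parShared _ _ _ Φ x i).trans
    (sum_unitIndex (g i) fun q => (Φ q).realize (unitLayers F d k) x ())

theorem size_combined_le {r : ℕ} (F : QuadNeurons r) {d k n μ : ℕ} {s : Fin n → ℕ} {β : Type}
    [Fintype β] (g : β → Fin n × Fin μ → ℝ) (hg : ∀ q, vnz (fun i => g i q) ≤ 1)
    (Φ : UnitIndex n s μ (numDirections d k) → INet (unitLayers F d k) (Fin d) Unit) (S : ℕ)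
    (hΦ : ∀ q, (Φ q).size _ ≤ S) :
    (combined F g Φ).size _ ≤ μ * (∑ i, s i) * ((numDirections d k + 1) * S) := by
  refine (INet.size_parShared_le _ (fun q => hg _) _ _ Φ).trans ?_
  refine (Finset.sum_le_card_nsmul _ _ S fun q _ => hΦ q).trans (le_of_eq ?_)
  simp only [Finset.card_univ, Fintype.card_prod, Fintype.card_sigma, Fintype.card_option,
    Fintype.card_fin, smul_eq_mul]
  ring

/-- The activation functions of the hidden layers. -/
def hiddenActs {r : ℕ} (F : QuadNeurons r) (d k n μ : ℕ) (s : Fin n → ℕ) : List (List (ℝ → ℝ)) :=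
  if ∑ i, s i = 0 then [] else
    ((unitLayers F d k).map (Layer.copies (UnitIndex n s μ (numDirections d k)))).map Layer.acts

theorem mem_hiddenActs {r : ℕ} (F : QuadNeurons r) (d k n μ : ℕ) (s : Fin n → ℕ) :
    ∀ l ∈ hiddenActs F d k n μ s, ∀ ϱ ∈ l, ϱ ∈ ({relu, reluPow r, bisu} : Set (ℝ → ℝ)) := by
  intro l hl ϱ hϱ
  unfold hiddenActs at hl
  split_ifs at hl
  · simp at hl
  · simp only [List.map_map, List.mem_map, Function.comp_apply] at hl
    obtain ⟨L, hL, rfl⟩ := hl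
    rw [Layer.acts, List.mem_ofFn] at hϱ
    obtain ⟨i, rfl⟩ := hϱ
    generalize (Fintype.equivFin (Layer.copies _ L).ι).symm i = q
    change L.act q.2 ∈ _
    simp only [unitLayers, List.mem_cons] at hL
    rcases hL with rfl | rfl | hL
    · rcases q.2 with j | j
      · exact Or.inr (Or.inr rfl)
      · exact Or.inl rfl
    · exact Or.inl rfl
    · rw [(mem_estrinLayers F _ L hL).2]
      exact Or.inr (Or.inl rfl)

theorem unitLayers_card_pos {r : ℕ} (F : QuadNeurons r) (d k : ℕ) {Q : Type} [Fintype Q]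
    [Nonempty Q] : ∀ L ∈ (unitLayers F d k).map (Layer.copies Q), 0 < Fintype.card L.ι := by
  intro L hL
  obtain ⟨L', hL', rfl⟩ := List.mem_map.1 hL
  have h : 0 < Fintype.card L'.ι := by
    simp only [unitLayers, List.mem_cons] at hL'
    rcases hL' with rfl | rfl | hL'
    · exact Fintype.card_pos_iff.2 ⟨Sum.inl 0⟩
    · exact Fintype.card_pos_iff.2 ⟨true⟩
    · exact (mem_estrinLayers F _ L' hL').1
  change 0 < Fintype.card (Q × L'.ι)
  rw [Fintype.card_prod]
  exact Nat.mul_pos Fintype.card_pos h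

/-- The additive constants are absorbed using `log (k + 1) ≥ log 2`; the rest is `2 ^ (clog - 1) < k
+ 1`. -/
theorem length_hiddenActs_le {r : ℕ} (F : QuadNeurons r) {d k : ℕ} (hd : 2 ≤ d) (hk : 1 ≤ k)
    (n μ : ℕ) (s : Fin n → ℕ) :
    (((hiddenActs F d k n μ s).length + 1 : ℕ) : ℝ) ≤ 8 * d * Real.log (k + 1) := by
  have h1 : (hiddenActs F d k n μ s).length ≤ Nat.clog 2 (k + 1) + 2 := by
    unfold hiddenActs
    split_ifs
    · simp
    · simp [unitLayers, length_estrinLayers]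
  have hlog2 := Real.log_two_gt_d9
  have h2 : (2 : ℝ) ≤ d := by exact_mod_cast hd
  have h3 : Real.log 2 ≤ Real.log (k + 1) := by
    refine Real.log_le_log two_pos ?_
    have : (1 : ℝ) ≤ k := by exact_mod_cast hk
    linarith
  have h4 : ((Nat.clog 2 (k + 1) - 1 : ℕ) : ℝ) * Real.log 2 ≤ Real.log (k + 1) := by
    rw [← Real.log_pow]
    refine Real.log_le_log (by positivity) ?_
    have h6 := Nat.pow_pred_clog_lt_self one_lt_two (x := k + 1) (by omega)
    rw [Nat.pred_eq_sub_one] at h6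
    exact_mod_cast h6.le
  have h5 : (((hiddenActs F d k n μ s).length + 1 : ℕ) : ℝ) ≤
      ((Nat.clog 2 (k + 1) - 1 : ℕ) : ℝ) + 4 := by
    exact_mod_cast (by omega : (hiddenActs F d k n μ s).length + 1 ≤ Nat.clog 2 (k + 1) - 1 + 4)
  nlinarith

/-- Networks emulating linear combinations of finite element functions, with the same hidden
layers for all linear combinations. -/
theorem exists_net_family {r : ℕ} (F : QuadNeurons r) {d k n μ : ℕ} (hd : 2 ≤ d) (hk : 1 ≤ k)
    (hμ : 0 < μ) {Ω : Set (Fin d → ℝ)} (hΩ : Bornology.IsBounded Ω) (s : Fin n → ℕ)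
    (Λ : ∀ i, Fin (s i) → Fin (d + 1) → Fin d → ℝ) (τ : ∀ i, Fin (s i) → Fin (d + 1) → ℝ)
    (w : ∀ i, Fin (s i) → Fin μ → MvPolynomial (Fin d) ℝ)
    (hw : ∀ i t j, (w i t j).totalDegree ≤ k) :
    ∃ H : List LayerData, ∀ (N : ℕ) (β : Type) (_ : Fintype β) (f : β ≃ Fin N)
      (g : β → Fin n × Fin μ → ℝ), (∀ q, vnz (fun i => g i q) ≤ 1) →
      ∃ Φ : Net d N, Φ.hiddenLayers = H ∧ Φ.activations = hiddenActs F d k n μ s ∧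
        (Φ.size : ℝ) ≤ (41 + 4 * (20 * Fintype.card F.ι + (4 * Fintype.card F.ι *
          (6 * Fintype.card F.ι + 1) + 24 * Fintype.card F.ι + 1)) : ℕ) * μ * (k + 1) ^ d *
          ∑ i, (s i : ℝ) ∧
        ∀ x ∈ Ω, ∀ i, Φ.realize x (f i) = ∑ q, g i q * ∑ t,
          if ∀ l, 0 < affine (Λ q.1 t) (τ q.1 t) x l then
            MvPolynomial.eval x (w q.1 t q.2) else 0 := by
  -- If no element carries any function, the size bound is `0` and the index set of the parallel
  -- networks is empty, so a bare zero output layer is used, as in `hiddenActs`.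
  by_cases h0 : ∑ i, s i = 0
  · refine ⟨[], fun N β _ f g _ => ⟨.out 0 0, rfl, ?_, ?_, fun x _ i => ?_⟩⟩
    · rw [hiddenActs, if_pos h0]
      rfl
    · have : (Net.out (0 : Matrix (Fin N) (Fin d) ℝ) 0).size = 0 := by simp [Net.size, layerSize]
      rw [this, Nat.cast_zero]
      positivity
    · have hs : ∀ i, s i = 0 := fun i => by simpa using (Finset.sum_eq_zero_iff.1 h0) i
      have he : ∀ i, IsEmpty (Fin (s i)) := fun i => by rw [hs i]; infer_instance
      simp [Net.realize]
  · have hQ : Nonempty (UnitIndex n s μ (numDirections d k)) := by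
      obtain ⟨i, -, hi⟩ := Finset.exists_ne_zero_of_sum_ne_zero h0
      exact ⟨(⟨i, ⟨0, Nat.pos_of_ne_zero hi⟩⟩, ⟨0, hμ⟩, none)⟩
    choose Φ hΦ hreal using fun (i : Fin n) (t : Fin (s i)) (j : Fin μ) =>
      exists_localPoly F ⟨0, by omega⟩ hk hΩ (Λ i t) (τ i t) (w i t j) (hw i t j)
    set Ψ : UnitIndex n s μ (numDirections d k) → INet (unitLayers F d k) (Fin d) Unit :=
      fun q => Φ q.1.1 q.1.2 q.2.1 q.2.2 with hΨ
    have hpos := unitLayers_card_pos F d k (Q := UnitIndex n s μ (numDirections d k))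
    -- The common hidden layers are read off from the network without outputs.
    refine ⟨((combined F (β := Empty) (fun i => i.elim) Ψ).toNet _ hpos (Equiv.refl _)
      (Equiv.equivOfIsEmpty Empty (Fin 0))).hiddenLayers, fun N β _ f g hg =>
        ⟨(combined F g Ψ).toNet _ hpos (Equiv.refl _) f, ?_, ?_, ?_, fun x hx i => ?_⟩⟩
    · exact INet.hiddenLayers_toNet_parShared _ _ _ _ hpos _ _ _ Ψ
    · rw [INet.activations_toNet, hiddenActs, if_neg h0]
    · rw [INet.size_toNet]
      have h1 := size_combined_le F g hg Ψ _ fun q => hΦ q.1.1 q.1.2 q.2.1 q.2.2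
      have h2 := h1.trans (Nat.mul_le_mul_left _ (succ_numDirections_mul_le hd hk _))
      refine (Nat.cast_le (α := ℝ).2 h2).trans (le_of_eq ?_)
      push_cast
      ring
    · rw [INet.realize_toNet]
      beta_reduce
      rw [Equiv.symm_apply_apply, realize_combined]
      refine Finset.sum_congr rfl fun q _ => ?_
      congr 1
      exact Finset.sum_congr rfl fun t _ => hreal q.1 t q.2 x hx

/-! ### Linear combinations and the linear structure on the networks. -/

theorem coeFn_sum_smul {d μ n : ℕ} {Ω : Set (Fin d → ℝ)} (c : Fin n → ℝ) (f : Fin n → AEFun Ω μ) :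
    ∀ᵐ x ∂(volume.restrict Ω), (∑ i, c i • f i : AEFun Ω μ) x = ∑ i, c i • f i x := by
  have h : ∀ S : Finset (Fin n), ∀ᵐ x ∂(volume.restrict Ω),
      (∑ i ∈ S, c i • f i : AEFun Ω μ) x = ∑ i ∈ S, c i • f i x := by
    intro S
    classical
    induction S using Finset.induction_on with
    | empty =>
      filter_upwards [AEEqFun.coeFn_zero (μ := volume.restrict Ω) (α := Fin d → ℝ)
        (β := Fin μ → ℝ)] with x hx
      simp [hx]
    | insert i S hi ih =>
      rw [Finset.sum_insert hi]
      filter_upwards [ih, AEEqFun.coeFn_add (c i • f i) (∑ i ∈ S, c i • f i),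
        AEEqFun.coeFn_smul (c i) (f i)] with x h1 h2 h3
      rw [h2, Pi.add_apply, h1, h3, Pi.smul_apply, Finset.sum_insert hi]
  exact h Finset.univ

/-- The linear structure on a family of networks indexed injectively by a vector space. -/
theorem exists_module_range {E : Type*} [AddCommGroup E] [Module ℝ E] {d m : ℕ} (Ψ : E → Net d m)
    (hΨ : Function.Injective Ψ) :
    ∃ (_ : AddCommGroup (Set.range Ψ)) (_ : Module ℝ (Set.range Ψ)),
      (∀ (v w : E) (c : ℝ), Set.rangeFactorization Ψ v + c • Set.rangeFactorization Ψ w =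
        Set.rangeFactorization Ψ (v + c • w)) ∧
      ∃ e : Set.range Ψ ≃ₗ[ℝ] E, ∀ v, e (Set.rangeFactorization Ψ v) = v := by
  set φ := (Equiv.ofInjective Ψ hΨ).symm with hφ
  have h1 : ∀ v, φ (Set.rangeFactorization Ψ v) = v := fun v =>
    (Equiv.ofInjective Ψ hΨ).symm_apply_apply v
  let i1 : AddCommGroup (Set.range Ψ) := φ.addCommGroup
  let i2 : Module ℝ (Set.range Ψ) := φ.module ℝ
  refine ⟨i1, i2, fun v w c => ?_, φ.linearEquiv ℝ, h1⟩
  apply (φ.linearEquiv ℝ).injective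
  rw [map_add, map_smul]
  change φ _ + c • φ _ = φ _
  rw [h1, h1, h1]

theorem FEKind.valueDim_pos {d : ℕ} (hd : 2 ≤ d) (K : FEKind) : 0 < K.valueDim d := by
  cases K <;> simp only [FEKind.valueDim] <;> omega

end FEMNet

end

open MeasureTheory FEMNet in
theorem proposition7p3 (r : ℕ) (hr : 2 ≤ r) :
    -- The constant depends on `r` only. The widths and the activation functions of the hidden
    -- layers are functions of the kind of element, `d`, `k`, the number `n` of basis functions and
    -- the numbers `s i` alone.
    ∃ C : ℝ, 0 < C ∧
    ∃ (width : FEKind → ℕ → ℕ → (n : ℕ) → (Fin n → ℕ) → List ℕ)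
      (act : FEKind → ℕ → ℕ → (n : ℕ) → (Fin n → ℕ) → List (List (ℝ → ℝ))),
    ∀ (d : ℕ), 2 ≤ d → ∀ (k : ℕ), 1 ≤ k →
    ∀ (Ω : Set (Fin d → ℝ)), IsPolytopalDomain Ω →
    ∀ (𝒯 : Finset (Finset (Fin d → ℝ))), IsRegularMesh Ω 𝒯 →
    ∀ (K : FEKind),
      FiniteDimensional ℝ (K.space k Ω 𝒯) ∧
      ∀ (n : ℕ) (θ : Module.Basis (Fin n) ℝ (K.space k Ω 𝒯)) (s : Fin n → ℕ),
        (∀ i, SupportedOn 𝒯 (θ i : AEFun Ω (K.valueDim d)) (s i)) →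
        ∃ (Φ : Net d (n * K.valueDim d)) (Ψ : K.space k Ω 𝒯 → Net d (K.valueDim d)),
          -- the network emulating the basis in parallel
          Φ.ActivationsIn {relu, reluPow r, bisu} ∧
          (∀ᵐ x ∂(volume.restrict Ω), ∀ (i : Fin n) (j : Fin (K.valueDim d)),
            Φ.realize x (finProdFinEquiv (i, j)) = (θ i : AEFun Ω (K.valueDim d)) x j) ∧
          (Φ.depth : ℝ) ≤ C * d * Real.log (k + 1) ∧
          (Φ.size : ℝ) ≤ C * K.valueDim d * (k + 1) ^ d * ∑ i, (s i : ℝ) ∧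
          Φ.layerDims = d :: (width K d k n s ++ [n * K.valueDim d]) ∧
          Φ.activations = act K d k n s ∧
          -- the networks emulating the finite element functions
          (∀ v : K.space k Ω 𝒯,
            (Ψ v).ActivationsIn {relu, reluPow r, bisu} ∧
            (∀ᵐ x ∂(volume.restrict Ω),
              (Ψ v).realize x = (v : AEFun Ω (K.valueDim d)) x) ∧
            ((Ψ v).depth : ℝ) ≤ C * d * Real.log (k + 1) ∧
            ((Ψ v).size : ℝ) ≤ C * K.valueDim d * (k + 1) ^ d * ∑ i, (s i : ℝ) ∧
            (Ψ v).layerDims = d :: (width K d k n s ++ [K.valueDim d]) ∧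
            (Ψ v).activations = act K d k n s ∧
            (Ψ v).hiddenLayers = Φ.hiddenLayers) ∧
          -- the set of these networks is a vector space, isomorphic to the finite element space
          ∃ (_ : AddCommGroup (Set.range Ψ)) (_ : Module ℝ (Set.range Ψ)),
            (∀ (v w : K.space k Ω 𝒯) (c : ℝ),
              Set.rangeFactorization Ψ v + c • Set.rangeFactorization Ψ w =
                Set.rangeFactorization Ψ (v + c • w)) ∧
            ∃ e : Set.range Ψ ≃ₗ[ℝ] K.space k Ω 𝒯,
              ∀ N : Set.range Ψ, ∀ᵐ x ∂(volume.restrict Ω),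
                (N : Net d (K.valueDim d)).realize x = (e N : AEFun Ω (K.valueDim d)) x := by

  obtain ⟨F⟩ := exists_quadNeurons hr
  -- The constant of the size bound depends only on the number of neurons in `F`, hence on `r`; it
  -- also exceeds the `8` of the depth bound.
  set C : ℕ := 41 + 4 * (20 * Fintype.card F.ι + (4 * Fintype.card F.ι *
    (6 * Fintype.card F.ι + 1) + 24 * Fintype.card F.ι + 1)) with hC
  have hC8 : (8 : ℝ) ≤ C := by
    have : 8 ≤ C := by omega
    exact_mod_cast this
  refine ⟨C, by linarith, fun K d k n s => (hiddenActs F d k n (K.valueDim d) s).map List.length,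
    fun K d k n s => hiddenActs F d k n (K.valueDim d) s, ?_⟩
  intro d hd k hk Ω hΩ 𝒯 h𝒯 K
  refine ⟨K.finiteDimensional_space hk hΩ.isOpen h𝒯, fun n θ s hs => ?_⟩
  set μ := K.valueDim d with hμ
  choose Λ τ w hw hθ using fun i =>
    h𝒯.exists_local_sum hΩ.isOpen (K.isPiecewise hk (θ i).2) (hs i)
  obtain ⟨H, hH⟩ := exists_net_family F hd hk (K.valueDim_pos hd) hΩ.isBounded s Λ τ w hw
  -- Identity output weights give the basis; for `Ψ v`, component `j` of `θ i` goes to output `j`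
  -- with the coordinate of `v` as weight. Both weight matrices have at most one nonzero entry per
  -- column.
  obtain ⟨Φ, hΦH, hΦact, hΦsize, hΦ⟩ := hH _ _ inferInstance
    (finProdFinEquiv (m := n) (n := μ)) (fun i q => (Pi.single q 1 : Fin n × Fin μ → ℝ) i)
    fun q => vnz_single_le q 1
  choose Ψ hΨH hΨact hΨsize hΨ using fun v : K.space k Ω 𝒯 => hH _ _ inferInstance
    (Equiv.refl (Fin μ)) (fun j q => (Pi.single q.2 (θ.repr v q.1) : Fin μ → ℝ) j)
    fun q => vnz_single_le q.2 _
  have hdepth : ((hiddenActs F d k n μ s).length + 1 : ℕ) ≤ (C : ℝ) * d * Real.log (k + 1) := by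
    refine (length_hiddenActs_le F hd hk n μ s).trans ?_
    have : 0 ≤ Real.log ((k : ℝ) + 1) := Real.log_nonneg (by linarith [Nat.cast_nonneg (α := ℝ) k])
    gcongr
  have hmem : ∀ᵐ x ∂(volume.restrict Ω), x ∈ Ω := ae_restrict_mem hΩ.isOpen.measurableSet
  have hΨreal : ∀ v : K.space k Ω 𝒯, ∀ᵐ x ∂(volume.restrict Ω),
      (Ψ v).realize x = (v : AEFun Ω (K.valueDim d)) x := by
    intro v
    have hv : (v : AEFun Ω μ) = ∑ i, θ.repr v i • (θ i : AEFun Ω μ) := by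
      conv_lhs => rw [← θ.sum_repr v]
      rw [AddSubmonoidClass.coe_finsetSum]
      rfl
    have h1 := coeFn_sum_smul (fun i => θ.repr v i) fun i => (θ i : AEFun Ω μ)
    rw [← hv] at h1
    filter_upwards [h1, ae_all_iff.2 hθ, hmem] with x h1 h2 hx
    rw [h1]
    funext j
    refine (hΨ v x hx j).trans ?_
    rw [Fintype.sum_prod_type, Finset.sum_apply]
    refine Finset.sum_congr rfl fun i _ => ?_
    rw [Fintype.sum_eq_single j, Pi.single_eq_same, Pi.smul_apply, smul_eq_mul, h2 i j]
    intro j' hj'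
    rw [Pi.single_eq_of_ne hj'.symm, zero_mul]
  refine ⟨Φ, Ψ, ?_, ?_, ?_, hΦsize, ?_, hΦact, fun v => ⟨?_, hΨreal v, ?_, hΨsize v, ?_, hΨact v,
    (hΨH v).trans hΦH.symm⟩, ?_⟩
  · rw [Net.ActivationsIn, hΦact]
    exact mem_hiddenActs F d k n μ s
  · filter_upwards [ae_all_iff.2 hθ, hmem] with x h2 hx i j
    rw [hΦ x hx, Fintype.sum_eq_single (i, j), Pi.single_eq_same, one_mul, h2 i j]
    intro q hq
    rw [Pi.single_eq_of_ne hq.symm, zero_mul]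
  · rw [Net.depth_eq, hΦact]
    exact hdepth
  · rw [Net.layerDims_eq, hΦact]
  · rw [Net.ActivationsIn, hΨact]
    exact mem_hiddenActs F d k n μ s
  · rw [Net.depth_eq, hΨact]
    exact hdepth
  · rw [Net.layerDims_eq, hΨact]
  -- A network determines its realization and thereby `v` almost everywhere, so the linear structure
  -- can be transported along `Ψ`.
  · have hinj : Function.Injective Ψ := by
      intro v w hvw
      refine Subtype.ext (AEEqFun.ext ?_)
      filter_upwards [hΨreal v, hΨreal w] with x h1 h2
      rw [← h1, ← h2, hvw]
    obtain ⟨i1, i2, hlin, e, he⟩ := exists_module_range Ψ hinj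
    refine ⟨i1, i2, hlin, e, ?_⟩
    rintro ⟨_, v, rfl⟩
    have := he v
    rw [show (⟨Ψ v, v, rfl⟩ : Set.range Ψ) = Set.rangeFactorization Ψ v from rfl, this]
    exact hΨreal v
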